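/- Let $E$ be a real or complex Hilbert space, let $A$ be a bounded linear operator on $E$ with adjoint $A'$, and let $D,\Sigma$ be symmetric bounded operators on $E$. Let $c_A,c_D,m_D,c_\Sigma>0$ be real numbers with $$A+A'\le -2c_A I,\qquad m_D I\le D\le c_D I,\qquad \Sigma\ge -c_\Sigma I$$ in the Loewner order, and suppose that $$c_A^2\ge c_Dc_\Sigma,\qquad c_\Sigma m_D>\Bigl(c_A-\sqrt{c_A^2-c_Dc_\Sigma}\Bigr)^2 .$$ Let $P\mapsto M_t(P)$ be the flow of the Riccati differential equation $\dot P=A'P+PA+D-P\Sigma P$ on the space of symmetric bounded operators, so that $t\mapsto M_t(P)$ is the maximal solution starting from $P$ at time $0$. For $\lambda>0$ let $(0,\lambda I]$ be the set of positive semi-definite invertible symmetric bounded operators $P$ with $P\le\lambda I$. For positive semi-definite invertible $P,Q$ let $d_T(P,Q)=\log\max\{M(P/Q),M(Q/P)\}$, where $M(P/Q)=\inf\{t\in\mathbb R: P\le tQ\}$, be the Thompson metric. Let $$\lambda\in\Bigl[\tfrac{c_A-\sqrt{c_A^2-c_Dc_\Sigma}}{c_\Sigma},\ \sqrt{\tfrac{m_D}{c_\Sigma}}\Bigr).$$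 Then for every $P\in(0,\lambda I]$ the solution $t\mapsto M_t(P)$ is unique, exists for all $t\ge0$ and stays in $(0,\lambda I]$, and there is $\alpha>0$ with $\alpha\ge (m_D-c_\Sigma\lambda^2)/\lambda$ such that for all $P_1,P_2\in(0,\lambda I]$ $$d_T(M_t(P_1),M_t(P_2))\le e^{-\alpha t}d_T(P_1,P_2),\qquad t\ge0.$$ Moreover the algebraic Riccati equation $A'P+PA+D-P\Sigma P=0$ has a unique solution $\bar P$ in $(0,\lambda I]$, and for every $P\in(0,\lambda I]$ $$d_T(M_t(P),\bar P)\le e^{-\alpha t}d_T(P,\bar P),\qquad t\ge0.$$ -/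

import Mathlib

noncomputable section

namespace Riccati

open Set

/-! ## Cauchy problems and flows in a real Banach space -/

section Flow

variable {X : Type*} [NormedAddCommGroup X] [NormedSpace ℝ X]

/-- `x` is a solution on `[0, a)` of the autonomous Cauchy problem `x' = φ(x)`, `x(0) = x₀`.
(At `0` the derivative is the right derivative. When `φ` is continuous, the derivative of a
solution is automatically continuous.) -/
def IsSolution (φ : X → X) (x₀ : X) (a : ℝ) (x : ℝ → X) : Prop :=
  x 0 = x₀ ∧ ∀ t ∈ Ico 0 a, HasDerivWithinAt x (φ (x t)) (Ico 0 a) t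

/-- The times `t ≥ 0` up to which the Cauchy problem `x' = φ(x)`, `x(0) = x₀` is solvable,
i.e. the interval of definition of the maximal solution. -/
def lifeInterval (φ : X → X) (x₀ : X) : Set ℝ :=
  {t | 0 ≤ t ∧ ∃ a x, t < a ∧ IsSolution φ x₀ a x}

open Classical in
/-- The flow: `flow φ t x₀` is the value at time `t` of the maximal solution of `x' = φ(x)`,
`x(0) = x₀` (and `0` for the times at which it does not exist). -/
def flow (φ : X → X) (t : ℝ) (x₀ : X) : X :=
  if h : t ∈ lifeInterval φ x₀ then h.2.choose_spec.choose t else 0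

end Flow

/-! ## The Thompson part metric -/

section Thompson

variable {X : Type*} [LE X] [SMul ℝ X]

/-- `M(x/y) = inf {t ∈ ℝ : x ≤ t y}`. -/
def maxRatio (x y : X) : ℝ := sInf {t : ℝ | x ≤ t • y}

/-- The Thompson part metric `d_T(x, y) = log max {M(x/y), M(y/x)}`. -/
def thompsonDist (x y : X) : ℝ := Real.log (max (maxRatio x y) (maxRatio y x))

end Thompson

/-! ## Symmetric operators on a real or complex Hilbert space -/

section Operators

variable (𝕜 E : Type*) [RCLike 𝕜] [NormedAddCommGroup E] [InnerProductSpace 𝕜 E]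
  [CompleteSpace E]

/-- The symmetric bounded operators on `E`, with the operator norm and the Loewner order
`P ≤ Q ↔ (Q - P).IsPositive`. -/
def SymOp : Type _ := selfAdjoint (E →L[𝕜] E)

instance SymOp.instNormedAddCommGroup : NormedAddCommGroup (SymOp 𝕜 E) :=
  inferInstanceAs (NormedAddCommGroup (selfAdjoint (E →L[𝕜] E)))

instance SymOp.instPartialOrder : PartialOrder (SymOp 𝕜 E) :=
  inferInstanceAs (PartialOrder (selfAdjoint (E →L[𝕜] E)))

/-- The identity operator. -/
instance SymOp.instOne : One (SymOp 𝕜 E) :=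
  inferInstanceAs (One (selfAdjoint (E →L[𝕜] E)))

instance SymOp.instCoeOut : CoeOut (SymOp 𝕜 E) (E →L[𝕜] E) := ⟨Subtype.val⟩

theorem SymOp.norm_def (P : SymOp 𝕜 E) : ‖P‖ = ‖(P : E →L[𝕜] E)‖ := rfl

theorem SymOp.le_iff (P Q : SymOp 𝕜 E) :
    P ≤ Q ↔ ((Q : E →L[𝕜] E) - (P : E →L[𝕜] E)).IsPositive := Iff.rfl

/-- The symmetric operators form a real vector space: `r • P` is the operator `(r : 𝕜) • P`. -/
instance SymOp.instModule : Module ℝ (SymOp 𝕜 E) where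
  smul r P := ⟨(r : 𝕜) • (P : E →L[𝕜] E), by
    rw [selfAdjoint.mem_iff, star_smul, RCLike.star_def, RCLike.conj_ofReal,
      selfAdjoint.mem_iff.mp P.2]⟩
  one_smul P := Subtype.ext (by
    change ((1 : ℝ) : 𝕜) • (P : E →L[𝕜] E) = P
    rw [RCLike.ofReal_one, one_smul])
  mul_smul r s P := Subtype.ext (by
    change ((r * s : ℝ) : 𝕜) • (P : E →L[𝕜] E) = (r : 𝕜) • (s : 𝕜) • (P : E →L[𝕜] E)
    rw [RCLike.ofReal_mul, mul_smul])
  smul_zero r := Subtype.ext (by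
    change (r : 𝕜) • (0 : E →L[𝕜] E) = 0
    rw [smul_zero])
  smul_add r P Q := Subtype.ext (by
    change (r : 𝕜) • ((P : E →L[𝕜] E) + Q) = (r : 𝕜) • (P : E →L[𝕜] E) + (r : 𝕜) • (Q : E →L[𝕜] E)
    rw [smul_add])
  add_smul r s P := Subtype.ext (by
    change ((r + s : ℝ) : 𝕜) • (P : E →L[𝕜] E) = (r : 𝕜) • (P : E →L[𝕜] E) + (s : 𝕜) • (P : E →L[𝕜] E)
    rw [RCLike.ofReal_add, add_smul])
  zero_smul P := Subtype.ext (by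
    change ((0 : ℝ) : 𝕜) • (P : E →L[𝕜] E) = 0
    rw [RCLike.ofReal_zero, zero_smul])

theorem SymOp.coe_smul (r : ℝ) (P : SymOp 𝕜 E) :
    ((r • P : SymOp 𝕜 E) : E →L[𝕜] E) = (r : 𝕜) • (P : E →L[𝕜] E) := rfl

theorem SymOp.coe_one : ((1 : SymOp 𝕜 E) : E →L[𝕜] E) = 1 := rfl

instance SymOp.instNormedSpace : NormedSpace ℝ (SymOp 𝕜 E) where
  norm_smul_le r P := by
    change ‖(r : 𝕜) • (P : E →L[𝕜] E)‖ ≤ ‖r‖ * ‖(P : E →L[𝕜] E)‖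
    rw [norm_smul, RCLike.norm_ofReal, Real.norm_eq_abs]

variable {𝕜 E}

/-- The Riccati field `φ(P) = A' P + P A + D - P S P`, where `A'` is the adjoint of `A`. -/
def riccatiField (A : E →L[𝕜] E) (D S P : SymOp 𝕜 E) : SymOp 𝕜 E :=
  ⟨star A * (P : E →L[𝕜] E) + (P : E →L[𝕜] E) * A + (D : E →L[𝕜] E)
      - (P : E →L[𝕜] E) * (S : E →L[𝕜] E) * (P : E →L[𝕜] E), by
    have hP := selfAdjoint.mem_iff.mp P.2
    have hD := selfAdjoint.mem_iff.mp D.2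
    have hS := selfAdjoint.mem_iff.mp S.2
    rw [selfAdjoint.mem_iff]
    simp only [star_sub, star_add, star_mul, star_star, hP, hD, hS]
    rw [add_comm ((P : E →L[𝕜] E) * A), mul_assoc]⟩

/-- The algebraic Riccati equation `A' P + P A + D - P S P = 0`. -/
def SolvesARE (A : E →L[𝕜] E) (D S P : SymOp 𝕜 E) : Prop :=
  star A * (P : E →L[𝕜] E) + (P : E →L[𝕜] E) * A + (D : E →L[𝕜] E)
    - (P : E →L[𝕜] E) * (S : E →L[𝕜] E) * (P : E →L[𝕜] E) = 0

variable (𝕜 E) in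
/-- The set `(0, r I]` of the positive semi-definite invertible operators `P` with `P ≤ r I`. -/
def posUpTo (r : ℝ) : Set (SymOp 𝕜 E) :=
  {P | (P : E →L[𝕜] E).IsPositive ∧ IsUnit (P : E →L[𝕜] E) ∧ P ≤ r • (1 : SymOp 𝕜 E)}

end Operators

end Riccati

end

/-! Order comparison drives everything. The difference of two values of the Riccati field is linear
in P - Q up to symmetrisation: it equals R'(P - Q) + (P - Q)R, where R is A - S(P + Q)/2
(`riccatiField_sub`). Such an equation with a nonnegative source preserves the positive cone
(`nonneg_of_lyapunov`), because (I + hR)'Z(I + hR) is positive and agrees with Z + h(R'Z + ZR) up to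
h².

Hence rI bounds the flow from above once the field is nonpositive there. This follows from c_S r² -
2c_A r + c_D ≤ 0, which says that r lies between the roots. Small multiples of I are lower barriers
because D ≥ m_D I. So the order intervals [εI, rI] are invariant and their solutions are global
(`exists_isSolution_riccatiField`).

For the contraction, let P ≤ μQ and let log μ decay at rate α. The derivative of μQ - P is a
Lyapunov term in μQ - P plus (μ - 1)D + (1 - 1/μ)PSP - α log μ P. Since 1 - 1/μ ≤ log μ ≤ μ - 1,
this source is at least log μ (m_D - c_S r² - αr)I, which vanishes for α = (m_D - c_S r²)/r. So P ≤
μQ persists (`IsSolution.le_exp_smul`), and using it in both directions contracts the Thompson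
metric.

For the equilibrium, x(t + h) and x(t) evolve from x(h) and rI, whose ratios are bounded uniformly
in h. The contraction makes the orbit Cauchy in operator norm, and its limit is an equilibrium
(`exists_equilibrium`). -/

noncomputable section

namespace Riccati

open Set Filter Topology
open scoped InnerProductSpace NNReal

/-! ### Quadratic forms and the Loewner order. -/

section Operators

variable {𝕜 E : Type*} [RCLike 𝕜] [NormedAddCommGroup E] [InnerProductSpace 𝕜 E]
  [CompleteSpace E]

@[simp] theorem SymOp.coe_add (P Q : SymOp 𝕜 E) :
    ((P + Q : SymOp 𝕜 E) : E →L[𝕜] E) = (P : E →L[𝕜] E) + Q := rfl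

@[simp] theorem SymOp.coe_sub (P Q : SymOp 𝕜 E) :
    ((P - Q : SymOp 𝕜 E) : E →L[𝕜] E) = (P : E →L[𝕜] E) - Q := rfl

@[simp] theorem SymOp.coe_neg (P : SymOp 𝕜 E) :
    ((-P : SymOp 𝕜 E) : E →L[𝕜] E) = -(P : E →L[𝕜] E) := rfl

@[simp] theorem SymOp.coe_zero : ((0 : SymOp 𝕜 E) : E →L[𝕜] E) = 0 := rfl

theorem SymOp.star_coe (P : SymOp 𝕜 E) : star (P : E →L[𝕜] E) = P :=
  selfAdjoint.mem_iff.mp P.2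

instance SymOp.instCompleteSpace : CompleteSpace (SymOp 𝕜 E) := by
  have h : IsClosed ((selfAdjoint (E →L[𝕜] E) : Set (E →L[𝕜] E))) := by
    have : (selfAdjoint (E →L[𝕜] E) : Set (E →L[𝕜] E)) = {T | star T = T} := by
      ext T
      exact selfAdjoint.mem_iff
    rw [this]
    exact isClosed_eq continuous_star continuous_id
  exact h.completeSpace_coe

/-- The quadratic form `x ↦ ⟨P x, x⟩` of a symmetric operator. -/
def quad (P : SymOp 𝕜 E) (x : E) : ℝ := RCLike.re ⟪(P : E →L[𝕜] E) x, x⟫_𝕜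

@[simp] theorem quad_add (P Q : SymOp 𝕜 E) (x : E) : quad (P + Q) x = quad P x + quad Q x := by
  simp [quad, inner_add_left]

@[simp] theorem quad_sub (P Q : SymOp 𝕜 E) (x : E) : quad (P - Q) x = quad P x - quad Q x := by
  simp [quad, inner_sub_left]

@[simp] theorem quad_neg (P : SymOp 𝕜 E) (x : E) : quad (-P) x = -quad P x := by
  simp [quad, inner_neg_left]

@[simp] theorem quad_zero (x : E) : quad (0 : SymOp 𝕜 E) x = 0 := by
  simp [quad]

@[simp] theorem quad_smul (c : ℝ) (P : SymOp 𝕜 E) (x : E) : quad (c • P) x = c * quad P x := by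
  simp [quad, SymOp.coe_smul, inner_smul_left]

@[simp] theorem quad_one (x : E) : quad (1 : SymOp 𝕜 E) x = ‖x‖ ^ 2 := by
  rw [quad, SymOp.coe_one, one_apply_eq_self, inner_self_eq_norm_sq]

theorem SymOp.isSymmetric (P : SymOp 𝕜 E) : (P : E →L[𝕜] E).IsSymmetric :=
  ContinuousLinearMap.isSelfAdjoint_iff_isSymmetric.mp P.2

theorem isPositive_coe_iff (P : SymOp 𝕜 E) :
    (P : E →L[𝕜] E).IsPositive ↔ ∀ x, 0 ≤ quad P x := by
  rw [ContinuousLinearMap.isPositive_def]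
  exact and_iff_right P.isSymmetric

theorem le_iff_quad {P Q : SymOp 𝕜 E} : P ≤ Q ↔ ∀ x, quad P x ≤ quad Q x := by
  rw [SymOp.le_iff, ← SymOp.coe_sub, isPositive_coe_iff]
  simp

theorem nonneg_iff_quad {P : SymOp 𝕜 E} : 0 ≤ P ↔ ∀ x, 0 ≤ quad P x := by
  simp [le_iff_quad]

theorem isPositive_coe_iff_nonneg (P : SymOp 𝕜 E) : (P : E →L[𝕜] E).IsPositive ↔ 0 ≤ P := by
  rw [isPositive_coe_iff, nonneg_iff_quad]

theorem abs_quad_le (P : SymOp 𝕜 E) (x : E) : |quad P x| ≤ ‖P‖ * ‖x‖ ^ 2 := by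
  calc |quad P x| ≤ ‖⟪(P : E →L[𝕜] E) x, x⟫_𝕜‖ := RCLike.abs_re_le_norm _
    _ ≤ ‖(P : E →L[𝕜] E) x‖ * ‖x‖ := norm_inner_le_norm _ _
    _ ≤ ‖P‖ * ‖x‖ * ‖x‖ := by
      gcongr
      exact (P : E →L[𝕜] E).le_opNorm x
    _ = ‖P‖ * ‖x‖ ^ 2 := by ring

/-- The norm of a symmetric operator is the supremum of its absolute Rayleigh quotients, so order
bounds become norm bounds. -/
theorem norm_le_of_abs_quad_le {P : SymOp 𝕜 E} {c : ℝ} (hc : 0 ≤ c)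
    (h : ∀ x, |quad P x| ≤ c * ‖x‖ ^ 2) : ‖P‖ ≤ c := by
  rw [SymOp.norm_def, ContinuousLinearMap.norm_eq_iSup_rayleighQuotient _ P.isSymmetric]
  refine ciSup_le fun x => ?_
  rw [ContinuousLinearMap.rayleighQuotient, abs_div, abs_of_nonneg (sq_nonneg ‖x‖)]
  exact div_le_of_le_mul₀ (sq_nonneg _) hc (h x)

theorem norm_le_of_nonneg_of_le {P : SymOp 𝕜 E} {c : ℝ} (hc : 0 ≤ c) (h0 : 0 ≤ P)
    (h1 : P ≤ c • (1 : SymOp 𝕜 E)) : ‖P‖ ≤ c := by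
  refine norm_le_of_abs_quad_le hc fun x => ?_
  rw [abs_of_nonneg (nonneg_iff_quad.mp h0 x)]
  simpa using le_iff_quad.mp h1 x

theorem isClosed_nonneg : IsClosed {P : SymOp 𝕜 E | 0 ≤ P} := by
  have : {P : SymOp 𝕜 E | 0 ≤ P} = ⋂ x, {P : SymOp 𝕜 E | 0 ≤ quad P x} := by
    ext P
    simp [nonneg_iff_quad]
  rw [this]
  refine isClosed_iInter fun x => isClosed_le continuous_const ?_
  have h : Continuous fun P : SymOp 𝕜 E => (P : E →L[𝕜] E) := continuous_subtype_val
  unfold quad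
  fun_prop

theorem nonneg_sub_iff {P Q : SymOp 𝕜 E} : 0 ≤ Q - P ↔ P ≤ Q := by
  simp [le_iff_quad]

theorem isClosed_Icc_symOp (P Q : SymOp 𝕜 E) : IsClosed {X : SymOp 𝕜 E | P ≤ X ∧ X ≤ Q} := by
  simp_rw [← nonneg_sub_iff (P := P), ← nonneg_sub_iff (Q := Q)]
  exact (isClosed_nonneg.preimage (continuous_id.sub continuous_const)).inter
    (isClosed_nonneg.preimage (continuous_const.sub continuous_id))

theorem isUnit_of_smul_one_le {P : SymOp 𝕜 E} {ε : ℝ} (hε : 0 < ε)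
    (h : ε • (1 : SymOp 𝕜 E) ≤ P) : IsUnit (P : E →L[𝕜] E) := by
  refine ContinuousLinearMap.isUnit_of_forall_le_norm_inner_map _ (c := ⟨ε, hε.le⟩) hε fun x => ?_
  have := le_iff_quad.mp h x
  simp only [quad_smul, quad_one] at this
  calc ‖x‖ ^ 2 * ε ≤ quad P x := by linarith
    _ ≤ _ := RCLike.re_le_norm _

/-- Positivity of the form is tested at x - sPx with s = 1/(‖P‖ + 1); the added 1 avoids dividing by
zero when P = 0. -/
theorem norm_apply_sq_le_of_nonneg {P : SymOp 𝕜 E} (h : 0 ≤ P) (x : E) :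
    ‖(P : E →L[𝕜] E) x‖ ^ 2 ≤ (‖P‖ + 1) * quad P x := by
  have hP : 0 < ‖P‖ + 1 := by positivity
  have hs : (‖P‖ + 1)⁻¹ * (‖P‖ + 1) = 1 := inv_mul_cancel₀ hP.ne'
  set s : ℝ := (‖P‖ + 1)⁻¹ with hsdef
  have hs0 : 0 < s := inv_pos.mpr hP
  set y := (P : E →L[𝕜] E) x with hy
  have h1 := nonneg_iff_quad.mp h (x - (s : 𝕜) • y)
  have h2 : quad P (x - (s : 𝕜) • y) = quad P x - 2 * s * ‖y‖ ^ 2 + s ^ 2 * quad P y := by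
    have hsym : ⟪(P : E →L[𝕜] E) y, x⟫_𝕜 = ⟪y, y⟫_𝕜 := P.isSymmetric y x
    simp only [quad, map_sub, map_smul, inner_sub_left, inner_sub_right, inner_smul_left,
      inner_smul_right, ← hy, RCLike.conj_ofReal, hsym, RCLike.re_ofReal_mul,
      inner_self_eq_norm_sq]
    ring
  have h3 : quad P y ≤ (‖P‖ + 1) * ‖y‖ ^ 2 :=
    (le_abs_self _).trans <| (abs_quad_le P y).trans <| by gcongr; linarith
  have h4 : s ^ 2 * quad P y ≤ s * ‖y‖ ^ 2 := by
    calc s ^ 2 * quad P y ≤ s ^ 2 * ((‖P‖ + 1) * ‖y‖ ^ 2) := by gcongr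
      _ = s * (s * (‖P‖ + 1)) * ‖y‖ ^ 2 := by ring
      _ = _ := by rw [hs, mul_one]
  have h5 : s * ‖y‖ ^ 2 ≤ quad P x := by linarith
  calc ‖y‖ ^ 2 = (‖P‖ + 1) * (s * ‖y‖ ^ 2) := by linear_combination (-‖y‖ ^ 2) * hs
    _ ≤ _ := by gcongr

/-- A bounded inverse bounds ‖Px‖ below, and the previous estimate transfers this to ⟨Px, x⟩. -/
theorem exists_smul_one_le_of_isUnit {P : SymOp 𝕜 E} (h : 0 ≤ P)
    (hu : IsUnit (P : E →L[𝕜] E)) : ∃ ε : ℝ, 0 < ε ∧ ε • (1 : SymOp 𝕜 E) ≤ P := by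
  obtain ⟨u, hu⟩ := hu
  set T : E →L[𝕜] E := ((u⁻¹ : (E →L[𝕜] E)ˣ) : E →L[𝕜] E) with hT
  have hP : 0 < ‖P‖ + 1 := by positivity
  have hT1 : 0 < ‖T‖ + 1 := by positivity
  refine ⟨((‖T‖ + 1) ^ 2 * (‖P‖ + 1))⁻¹, by positivity, le_iff_quad.mpr fun x => ?_⟩
  simp only [quad_smul, quad_one]
  rw [inv_mul_le_iff₀ (by positivity)]
  have h1 : T ((P : E →L[𝕜] E) x) = x := by
    have : T * (P : E →L[𝕜] E) = 1 := by rw [hT, ← hu]; simp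
    exact congrArg (fun f : E →L[𝕜] E => f x) this
  have h2 : ‖x‖ ≤ (‖T‖ + 1) * ‖(P : E →L[𝕜] E) x‖ := by
    calc ‖x‖ = ‖T ((P : E →L[𝕜] E) x)‖ := by rw [h1]
      _ ≤ ‖T‖ * ‖(P : E →L[𝕜] E) x‖ := T.le_opNorm _
      _ ≤ _ := by gcongr; linarith
  calc ‖x‖ ^ 2 ≤ ((‖T‖ + 1) * ‖(P : E →L[𝕜] E) x‖) ^ 2 := by gcongr
    _ = (‖T‖ + 1) ^ 2 * ‖(P : E →L[𝕜] E) x‖ ^ 2 := by ring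
    _ ≤ (‖T‖ + 1) ^ 2 * ((‖P‖ + 1) * quad P x) := by
      gcongr
      exact norm_apply_sq_le_of_nonneg h x
    _ = _ := by ring

/-! ### Congruences, Lyapunov operators and the Riccati field. -/

/-- The congruence `T' W T`. -/
def sandwich (T : E →L[𝕜] E) (W : SymOp 𝕜 E) : SymOp 𝕜 E :=
  ⟨star T * (W : E →L[𝕜] E) * T, by
    rw [selfAdjoint.mem_iff, star_mul, star_mul, star_star, W.star_coe, mul_assoc]⟩

/-- The Lyapunov operator `W ↦ R' W + W R`. -/
def lyap (R : E →L[𝕜] E) (W : SymOp 𝕜 E) : SymOp 𝕜 E :=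
  ⟨star R * (W : E →L[𝕜] E) + (W : E →L[𝕜] E) * R, by
    rw [selfAdjoint.mem_iff, star_add, star_mul, star_mul, star_star, W.star_coe, add_comm]⟩

@[simp] theorem coe_sandwich (T : E →L[𝕜] E) (W : SymOp 𝕜 E) :
    (sandwich T W : E →L[𝕜] E) = star T * (W : E →L[𝕜] E) * T := rfl

@[simp] theorem coe_lyap (R : E →L[𝕜] E) (W : SymOp 𝕜 E) :
    (lyap R W : E →L[𝕜] E) = star R * (W : E →L[𝕜] E) + (W : E →L[𝕜] E) * R := rfl

@[simp] theorem coe_riccatiField (A : E →L[𝕜] E) (D S P : SymOp 𝕜 E) :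
    (riccatiField A D S P : E →L[𝕜] E) = star A * (P : E →L[𝕜] E) + (P : E →L[𝕜] E) * A
      + (D : E →L[𝕜] E) - (P : E →L[𝕜] E) * (S : E →L[𝕜] E) * (P : E →L[𝕜] E) := rfl

theorem riccatiField_eq_zero_iff (A : E →L[𝕜] E) (D S P : SymOp 𝕜 E) :
    riccatiField A D S P = 0 ↔ SolvesARE A D S P := Subtype.ext_iff

@[simp] theorem quad_sandwich (T : E →L[𝕜] E) (W : SymOp 𝕜 E) (x : E) :
    quad (sandwich T W) x = quad W (T x) := by
  simp only [quad, coe_sandwich, ContinuousLinearMap.star_eq_adjoint,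
    mul_apply_eq_comp, ContinuousLinearMap.adjoint_inner_left]

theorem sandwich_nonneg (T : E →L[𝕜] E) {W : SymOp 𝕜 E} (h : 0 ≤ W) : 0 ≤ sandwich T W :=
  nonneg_iff_quad.mpr fun x => by
    rw [quad_sandwich]
    exact nonneg_iff_quad.mp h _

theorem norm_star_op (T : E →L[𝕜] E) : ‖star T‖ = ‖T‖ :=
  LinearIsometryEquiv.norm_map ContinuousLinearMap.adjoint T

theorem norm_sandwich_le (T : E →L[𝕜] E) (W : SymOp 𝕜 E) : ‖sandwich T W‖ ≤ ‖T‖ ^ 2 * ‖W‖ := by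
  rw [SymOp.norm_def, coe_sandwich, SymOp.norm_def _ _ W]
  calc _ ≤ ‖star T‖ * ‖(W : E →L[𝕜] E)‖ * ‖T‖ :=
        (norm_mul_le _ _).trans (by gcongr; exact norm_mul_le _ _)
    _ = _ := by rw [norm_star_op]; ring

theorem norm_lyap_le (R : E →L[𝕜] E) (W : SymOp 𝕜 E) : ‖lyap R W‖ ≤ 2 * ‖R‖ * ‖W‖ := by
  rw [SymOp.norm_def, coe_lyap, SymOp.norm_def _ _ W]
  calc _ ≤ ‖star R‖ * ‖(W : E →L[𝕜] E)‖ + ‖(W : E →L[𝕜] E)‖ * ‖R‖ :=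
        (norm_add_le _ _).trans (add_le_add (norm_mul_le _ _) (norm_mul_le _ _))
    _ = _ := by rw [norm_star_op]; ring

theorem sandwich_sub (T : E →L[𝕜] E) (V W : SymOp 𝕜 E) :
    sandwich T (V - W) = sandwich T V - sandwich T W :=
  Subtype.ext (by
    change star T * ((V : E →L[𝕜] E) - W) * T = star T * V * T - star T * W * T
    noncomm_ring)

theorem star_ofReal_smul (c : ℝ) (T : E →L[𝕜] E) : star ((c : 𝕜) • T) = (c : 𝕜) • star T := by
  rw [star_smul, RCLike.star_def, RCLike.conj_ofReal]

theorem sandwich_one_add_smul (h : ℝ) (R : E →L[𝕜] E) (W : SymOp 𝕜 E) :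
    sandwich (1 + (h : 𝕜) • R) W = W + h • lyap R W + (h ^ 2) • sandwich R W := by
  refine Subtype.ext ?_
  change (star (1 + (h : 𝕜) • R) * (W : E →L[𝕜] E) * (1 + (h : 𝕜) • R) : E →L[𝕜] E) =
    W + (h : 𝕜) • (star R * W + W * R) + ((h ^ 2 : ℝ) : 𝕜) • (star R * W * R)
  rw [star_add, star_one, star_ofReal_smul]
  simp only [add_mul, mul_add, smul_mul_assoc, mul_smul_comm, one_mul, mul_one, smul_add, smul_smul,
    RCLike.ofReal_mul, pow_two]
  abel

theorem smul_lyap (c : ℝ) (R : E →L[𝕜] E) (W : SymOp 𝕜 E) :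
    c • lyap R W = lyap ((c : 𝕜) • R) W := by
  refine Subtype.ext ?_
  change (c : 𝕜) • (star R * (W : E →L[𝕜] E) + W * R) =
    star ((c : 𝕜) • R) * (W : E →L[𝕜] E) + W * ((c : 𝕜) • R)
  rw [star_ofReal_smul]
  simp only [smul_mul_assoc, mul_smul_comm, smul_add]

/-- The closed-loop operator `A - S (P + Q) / 2`. -/
def closedLoop (A : E →L[𝕜] E) (S P Q : SymOp 𝕜 E) : E →L[𝕜] E :=
  A - ((2⁻¹ : ℝ) : 𝕜) • ((S : E →L[𝕜] E) * ((P : E →L[𝕜] E) + Q))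

theorem norm_closedLoop_le (A : E →L[𝕜] E) (S P Q : SymOp 𝕜 E) :
    ‖closedLoop A S P Q‖ ≤ ‖A‖ + ‖S‖ * (‖P‖ + ‖Q‖) := by
  refine (norm_sub_le _ _).trans ?_
  gcongr
  rw [norm_smul, RCLike.norm_ofReal]
  calc _ ≤ |(2⁻¹ : ℝ)| * (‖S‖ * (‖P‖ + ‖Q‖)) := by
        gcongr
        exact (norm_mul_le _ _).trans (by gcongr; exacts [le_rfl, norm_add_le _ _])
    _ ≤ 1 * (‖S‖ * (‖P‖ + ‖Q‖)) := by
        gcongr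
        norm_num [abs_of_pos]
    _ = _ := one_mul _

omit [CompleteSpace E] in
theorem half_smul_add_self (T : E →L[𝕜] E) :
    ((2⁻¹ : ℝ) : 𝕜) • T + ((2⁻¹ : ℝ) : 𝕜) • T = T := by
  rw [← add_smul, ← RCLike.ofReal_add]
  norm_num

/-- PSP - QSQ is half of (P + Q)S(P - Q) + (P - Q)S(P + Q). The identity yields both the local
Lipschitz bound and every order comparison below. -/
theorem riccatiField_sub (A : E →L[𝕜] E) (D S P Q : SymOp 𝕜 E) :
    riccatiField A D S P - riccatiField A D S Q = lyap (closedLoop A S P Q) (P - Q) := by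
  refine Subtype.ext ?_
  simp only [SymOp.coe_sub, coe_riccatiField, coe_lyap, closedLoop]
  rw [star_sub, star_ofReal_smul, star_mul, star_add, P.star_coe, Q.star_coe, S.star_coe]
  generalize (P : E →L[𝕜] E) = p
  generalize (Q : E →L[𝕜] E) = q
  generalize (S : E →L[𝕜] E) = s
  have h : p * s * p - q * s * q =
      ((2⁻¹ : ℝ) : 𝕜) • ((p + q) * s * (p - q) + (p - q) * s * (p + q)) := by
    rw [← half_smul_add_self (p * s * p - q * s * q), ← smul_add]
    congr 1
    noncomm_ring
  rw [sub_mul, mul_sub (p - q) A, smul_mul_assoc, mul_smul_comm]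
  have h' : p * s * p = q * s * q +
      ((2⁻¹ : ℝ) : 𝕜) • ((p + q) * s * (p - q) + (p - q) * s * (p + q)) := by
    rw [← h]; abel
  rw [h', smul_add, mul_assoc (p - q) s]
  noncomm_ring

end Operators

/-! ### Invariance of the positive cone under Lyapunov equations. -/

section Positivity

variable {𝕜 E : Type*} [RCLike 𝕜] [NormedAddCommGroup E] [InnerProductSpace 𝕜 E]
  [CompleteSpace E]

theorem zero_mem_nonneg : (0 : SymOp 𝕜 E) ∈ {W : SymOp 𝕜 E | 0 ≤ W} := le_refl (0 : SymOp 𝕜 E)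

/-- One Euler step: a nearly closest positive C is sent to (I + hR)'C(I + hR) + hF, which is again
positive. The remaining terms are the second-order part h² R'ZR and the Euler defect of Z₁. -/
theorem infDist_nonneg_step {Z Z₁ F : SymOp 𝕜 E} {R : E →L[𝕜] E} {L h : ℝ} (hR : ‖R‖ ≤ L)
    (hF : 0 ≤ F) (hh : 0 ≤ h) :
    Metric.infDist Z₁ {W : SymOp 𝕜 E | 0 ≤ W} ≤
      (1 + h * L) ^ 2 * Metric.infDist Z {W : SymOp 𝕜 E | 0 ≤ W} + h ^ 2 * (L ^ 2 * ‖Z‖)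
        + ‖Z₁ - Z - h • (lyap R Z + F)‖ := by
  have hL : 0 ≤ L := (norm_nonneg R).trans hR
  have hT : ‖(1 : E →L[𝕜] E) + (h : 𝕜) • R‖ ≤ 1 + h * L := by
    refine (norm_add_le _ _).trans (add_le_add ContinuousLinearMap.norm_id_le ?_)
    rw [norm_smul, RCLike.norm_ofReal, abs_of_nonneg hh]
    gcongr
  refine le_of_forall_pos_le_add fun δ hδ => ?_
  have hpos : 0 < (1 + h * L) ^ 2 := by positivity
  obtain ⟨C, hC, hCd⟩ := (Metric.infDist_lt_iff (x := Z) ⟨0, zero_mem_nonneg⟩).mp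
    (show Metric.infDist Z {W : SymOp 𝕜 E | 0 ≤ W} <
      Metric.infDist Z {W : SymOp 𝕜 E | 0 ≤ W} + δ / (1 + h * L) ^ 2 by
        have := div_pos hδ hpos; linarith)
  set T : E →L[𝕜] E := 1 + (h : 𝕜) • R with hTdef
  have hmem : sandwich T C + h • F ∈ {W : SymOp 𝕜 E | 0 ≤ W} := by
    have h1 := sandwich_nonneg T hC
    rw [nonneg_iff_quad] at h1 hF
    refine nonneg_iff_quad.mpr fun x => ?_
    rw [quad_add, quad_smul]
    exact add_nonneg (h1 x) (mul_nonneg hh (hF x))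
  refine (Metric.infDist_le_dist_of_mem hmem).trans ?_
  have hdec : Z₁ - (sandwich T C + h • F) =
      sandwich T (Z - C) + (Z₁ - Z - h • (lyap R Z + F)) - (h ^ 2) • sandwich R Z := by
    rw [sandwich_sub, hTdef, sandwich_one_add_smul h R Z]
    module
  rw [dist_eq_norm, hdec]
  have e1 : ‖sandwich T (Z - C)‖ ≤
      (1 + h * L) ^ 2 * Metric.infDist Z {W : SymOp 𝕜 E | 0 ≤ W} + δ := by
    calc _ ≤ ‖T‖ ^ 2 * ‖Z - C‖ := norm_sandwich_le _ _
      _ ≤ (1 + h * L) ^ 2 *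
          (Metric.infDist Z {W : SymOp 𝕜 E | 0 ≤ W} + δ / (1 + h * L) ^ 2) := by
        rw [← dist_eq_norm]
        gcongr
      _ = _ := by field_simp
  have e2 : ‖(h ^ 2) • sandwich R Z‖ ≤ h ^ 2 * (L ^ 2 * ‖Z‖) := by
    rw [norm_smul, Real.norm_eq_abs, abs_of_nonneg (sq_nonneg h)]
    gcongr
    exact (norm_sandwich_le _ _).trans (by gcongr)
  calc _ ≤ ‖sandwich T (Z - C)‖ + ‖Z₁ - Z - h • (lyap R Z + F)‖ + ‖(h ^ 2) • sandwich R Z‖ :=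
        (norm_sub_le _ _).trans (by gcongr; exact norm_add_le _ _)
    _ ≤ _ := by linarith

/-- A solution of a linear Lyapunov differential inequality that starts in the cone of positive
operators stays there. -/
theorem nonneg_of_lyapunov {Z : ℝ → SymOp 𝕜 E} {b L : ℝ} (hZ : ContinuousOn Z (Icc 0 b))
    (h0 : 0 ≤ Z 0)
    (hd : ∀ t ∈ Ico 0 b, ∃ (R : E →L[𝕜] E) (F : SymOp 𝕜 E), ‖R‖ ≤ L ∧ 0 ≤ F ∧
      HasDerivWithinAt Z (lyap R (Z t) + F) (Ici t) t) :
    ∀ t ∈ Icc 0 b, 0 ≤ Z t := by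
  set K : Set (SymOp 𝕜 E) := {W | 0 ≤ W} with hK
  -- The Euler step bounds the upper right derivative of the distance to the cone by 2L times that
  -- distance. Grönwall then keeps it zero, with no regularity of R or F in time.
  have key : ∀ t ∈ Icc 0 b, Metric.infDist (Z t) K ≤ gronwallBound 0 (2 * L) 0 (t - 0) := by
    refine le_gronwallBound_of_liminf_deriv_right_le
      (f' := fun t => 2 * L * Metric.infDist (Z t) K)
      ((Metric.continuous_infDist_pt K).comp_continuousOn hZ) ?_ ?_ ?_
    · intro t ht ρ hρ
      obtain ⟨R, F, hR, hF, hder⟩ := hd t ht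
      set g := Metric.infDist (Z t) K with hg
      have hder' := (hasDerivWithinAt_iff_tendsto_slope' self_notMem_Ioi).mp
        (hder.mono Ioi_subset_Ici_self)
      have hz : Tendsto (fun z : ℝ => z) (𝓝[>] t) (𝓝 t) := tendsto_id.mono_left inf_le_left
      have hlim : Tendsto (fun z => (2 * L + (z - t) * L ^ 2) * g + (z - t) * (L ^ 2 * ‖Z t‖)
          + ‖slope Z t z - (lyap R (Z t) + F)‖) (𝓝[>] t)
          (𝓝 ((2 * L + (t - t) * L ^ 2) * g + (t - t) * (L ^ 2 * ‖Z t‖)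
          + ‖(lyap R (Z t) + F) - (lyap R (Z t) + F)‖)) :=
        ((((hz.sub_const t).mul_const _).const_add _).mul_const _).add
          ((hz.sub_const t).mul_const _) |>.add (hder'.sub_const _).norm
      simp only [sub_self, zero_mul, add_zero, norm_zero] at hlim
      refine Eventually.frequently ?_
      filter_upwards [hlim.eventually_lt_const hρ, self_mem_nhdsWithin] with z hz1 hz2
      have hzt : 0 < z - t := sub_pos.mpr hz2
      refine lt_of_le_of_lt ?_ hz1
      rw [inv_mul_le_iff₀ hzt]
      have hstep := infDist_nonneg_step (Z := Z t) (Z₁ := Z z) hR hF hzt.le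
      have hs : ‖Z z - Z t - (z - t) • (lyap R (Z t) + F)‖ =
          (z - t) * ‖slope Z t z - (lyap R (Z t) + F)‖ := by
        rw [← abs_of_pos hzt, ← Real.norm_eq_abs, ← norm_smul, slope_def_module, smul_sub,
          smul_smul, Real.norm_eq_abs, abs_of_pos hzt, mul_inv_cancel₀ hzt.ne', one_smul]
      rw [hs] at hstep
      change Metric.infDist (Z z) K - g ≤ _
      change Metric.infDist (Z z) K ≤ _ * g + _ + _ at hstep
      linear_combination hstep
    · exact (Metric.infDist_zero_of_mem (s := K) h0).le
    · intro t _
      simp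
  intro t ht
  have h1 := key t ht
  rw [gronwallBound_ε0_δ0] at h1
  have h2 : Metric.infDist (Z t) K = 0 := le_antisymm h1 Metric.infDist_nonneg
  exact (isClosed_nonneg.mem_iff_infDist_zero ⟨0, zero_mem_nonneg⟩).mpr h2

end Positivity

/-! ### Uniqueness, the flow and equilibria in a Banach space. -/

section Flow

variable {X : Type*} [NormedAddCommGroup X] [NormedSpace ℝ X]

theorem IsSolution.continuousOn_Icc {φ : X → X} {x₀ : X} {a b : ℝ} {x : ℝ → X}
    (h : IsSolution φ x₀ a x) (hb : b < a) : ContinuousOn x (Icc 0 b) := fun t ht =>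
  (h.2 t ⟨ht.1, ht.2.trans_lt hb⟩).continuousWithinAt.mono fun _ hs => ⟨hs.1, hs.2.trans_lt hb⟩

theorem IsSolution.hasDerivWithinAt_Ici {φ : X → X} {x₀ : X} {a t : ℝ} {x : ℝ → X}
    (h : IsSolution φ x₀ a x) (ht : t ∈ Ico 0 a) : HasDerivWithinAt x (φ (x t)) (Ici t) t :=
  (h.2 t ht).mono_of_mem_nhdsWithin <|
    mem_of_superset (Ico_mem_nhdsGE ht.2) (Ico_subset_Ico_left ht.1)

theorem IsSolution.eqOn {φ : X → X}
    (hφ : ∀ ρ : ℝ, ∃ K : ℝ≥0, LipschitzOnWith K φ (Metric.closedBall 0 ρ))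
    {x₀ : X} {a b : ℝ} {x y : ℝ → X} (hx : IsSolution φ x₀ a x) (hy : IsSolution φ x₀ b y)
    {t : ℝ} (ht0 : 0 ≤ t) (hta : t < a) (htb : t < b) : x t = y t := by
  have hxc := hx.continuousOn_Icc hta
  have hyc := hy.continuousOn_Icc htb
  obtain ⟨C₁, hC₁⟩ := isCompact_Icc.exists_bound_of_continuousOn hxc
  obtain ⟨C₂, hC₂⟩ := isCompact_Icc.exists_bound_of_continuousOn hyc
  obtain ⟨K, hK⟩ := hφ (max C₁ C₂)
  refine ODE_solution_unique_of_mem_Icc_right (v := fun _ => φ) (a := 0) (b := t)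
    (s := fun _ => Metric.closedBall 0 (max C₁ C₂)) (K := K)
    (fun _ _ => hK) hxc (fun s hs => hx.hasDerivWithinAt_Ici ⟨hs.1, hs.2.trans hta⟩)
    (fun s hs => ?_) hyc (fun s hs => hy.hasDerivWithinAt_Ici ⟨hs.1, hs.2.trans htb⟩)
    (fun s hs => ?_) (hx.1.trans hy.1.symm) ⟨ht0, le_rfl⟩
  · exact mem_closedBall_zero_iff.mpr ((hC₁ s ⟨hs.1, hs.2.le⟩).trans (le_max_left _ _))
  · exact mem_closedBall_zero_iff.mpr ((hC₂ s ⟨hs.1, hs.2.le⟩).trans (le_max_right _ _))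

theorem IsSolution.eq_flow {φ : X → X}
    (hφ : ∀ ρ : ℝ, ∃ K : ℝ≥0, LipschitzOnWith K φ (Metric.closedBall 0 ρ))
    {x₀ : X} {a : ℝ} {x : ℝ → X} (hx : IsSolution φ x₀ a x) {t : ℝ} (ht : t ∈ Ico 0 a) :
    x t = flow φ t x₀ := by
  have h : t ∈ lifeInterval φ x₀ := ⟨ht.1, a, x, ht.2, hx⟩
  rw [flow, dif_pos h]
  have hs := h.2.choose_spec.choose_spec
  exact hx.eqOn hφ hs.2 ht.1 ht.2 hs.1

/-- If the Cauchy problem is solvable on every bounded interval, its flow is a solution. -/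
theorem isSolution_flow {φ : X → X}
    (hφ : ∀ ρ : ℝ, ∃ K : ℝ≥0, LipschitzOnWith K φ (Metric.closedBall 0 ρ))
    {x₀ : X} (h : ∀ a : ℝ, ∃ x, IsSolution φ x₀ a x) (a : ℝ) :
    IsSolution φ x₀ a fun t => flow φ t x₀ := by
  constructor
  · obtain ⟨x, hx⟩ := h 1
    have := hx.eq_flow hφ (t := 0) ⟨le_rfl, one_pos⟩
    exact this.symm.trans hx.1
  · intro t ht
    obtain ⟨x, hx⟩ := h a
    have h1 := hx.2 t ht
    rw [hx.eq_flow hφ ht] at h1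
    exact h1.congr (fun s hs => (hx.eq_flow hφ hs).symm) (hx.eq_flow hφ ht).symm

theorem IsSolution.shift {φ : X → X} {x₀ : X} {a s : ℝ} {x : ℝ → X} (h : IsSolution φ x₀ a x)
    (hs : 0 ≤ s) : IsSolution φ (x s) (a - s) fun t => x (t + s) := by
  refine ⟨by simp, fun t ht => ?_⟩
  have h1 := h.2 (t + s) ⟨add_nonneg ht.1 hs, by linarith [ht.2]⟩
  have h2 : HasDerivWithinAt (fun t : ℝ => t + s) 1 (Ico 0 (a - s)) t :=
    ((hasDerivAt_id t).add_const s).hasDerivWithinAt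
  have h4 : MapsTo (fun t : ℝ => t + s) (Ico 0 (a - s)) (Ico 0 a) := fun u hu =>
    ⟨add_nonneg hu.1 hs, by linarith [hu.2]⟩
  have h3 := h1.scomp t h2 h4
  rwa [one_smul] at h3

theorem isSolution_const {φ : X → X} {x₀ : X} (h : φ x₀ = 0) (a : ℝ) :
    IsSolution φ x₀ a fun _ => x₀ :=
  ⟨rfl, fun t _ => by rw [h]; exact hasDerivWithinAt_const t _ x₀⟩

/-- The limit of a convergent global solution is an equilibrium. -/
theorem eq_zero_of_tendsto {φ : X → X} {x₀ y : X} {x : ℝ → X} (hx : ∀ a, IsSolution φ x₀ a x)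
    (hy : Tendsto x atTop (𝓝 y)) (hφ : ContinuousAt φ y) : φ y = 0 := by
  have h1 : Tendsto (fun t => ‖φ (x t) - φ y‖) atTop (𝓝 0) := by
    simpa using ((hφ.tendsto.comp hy).sub_const (φ y)).norm
  have h2 : Tendsto (fun t => ‖x (t + 1) - x t‖) atTop (𝓝 0) := by
    simpa using ((hy.comp (tendsto_atTop_add_const_right _ (1 : ℝ) tendsto_id)).sub hy).norm
  rw [← norm_le_zero_iff]
  refine le_of_forall_pos_le_add fun δ hδ => ?_
  obtain ⟨T, hT⟩ := eventually_atTop.mp ((h1.eventually_lt_const (half_pos hδ)).and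
    (h2.eventually_lt_const (half_pos hδ)))
  set t := max T 0 with ht
  -- After removal of the drift u • φ y the velocity is small, so x(t + 1) - x(t) is close to φ y;
  -- convergence also makes it small.
  have hder : ∀ u ∈ Icc t (t + 1),
      HasDerivWithinAt (fun u => x u - u • φ y) (φ (x u) - φ y) (Icc t (t + 1)) u := by
    intro u hu
    have hsub : Icc t (t + 1) ⊆ Ico 0 (t + 2) := fun v hv =>
      ⟨(le_max_right T 0).trans hv.1, by linarith [hv.2]⟩
    have h3 := ((hx (t + 2)).2 u (hsub hu)).mono hsub
    have h4 : HasDerivWithinAt (fun u : ℝ => u • φ y) ((1 : ℝ) • φ y) (Icc t (t + 1)) u :=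
      ((hasDerivAt_id u).smul_const (φ y)).hasDerivWithinAt
    rw [one_smul] at h4
    exact h3.sub h4
  have h5 := norm_image_sub_le_of_norm_deriv_le_segment' hder (C := δ / 2)
    (fun u hu => (hT u ((le_max_left T 0).trans hu.1)).1.le) (t + 1) ⟨by linarith, le_rfl⟩
  have h6 : φ y = (x (t + 1) - x t) -
      ((x (t + 1) - (t + 1) • φ y) - (x t - t • φ y)) := by module
  have h7 := (hT t (le_max_left T 0)).2
  rw [h6]
  calc _ ≤ ‖x (t + 1) - x t‖ + ‖(x (t + 1) - (t + 1) • φ y) - (x t - t • φ y)‖ := norm_sub_le _ _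
    _ ≤ 0 + δ := by linarith

/-! ### Solutions of the truncated field on arbitrary time intervals. -/

/-- The cutoff that is `1` on the ball of radius `ρ` and `0` outside the ball of radius
`ρ + 1`. -/
def cutoff (ρ : ℝ) (x : X) : ℝ := max 0 (min 1 (ρ + 1 - ‖x‖))

omit [NormedSpace ℝ X] in
theorem cutoff_nonneg (ρ : ℝ) (x : X) : 0 ≤ cutoff ρ x := le_max_left _ _

omit [NormedSpace ℝ X] in
theorem cutoff_le_one (ρ : ℝ) (x : X) : cutoff ρ x ≤ 1 :=
  max_le zero_le_one (min_le_left _ _)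

omit [NormedSpace ℝ X] in
theorem cutoff_eq_one {ρ : ℝ} {x : X} (h : ‖x‖ ≤ ρ) : cutoff ρ x = 1 := by
  rw [cutoff, min_eq_left (by linarith), max_eq_right zero_le_one]

omit [NormedSpace ℝ X] in
theorem cutoff_eq_zero {ρ : ℝ} {x : X} (h : ρ + 1 ≤ ‖x‖) : cutoff ρ x = 0 :=
  max_eq_left ((min_le_right _ _).trans (by linarith))

omit [NormedSpace ℝ X] in
theorem abs_cutoff_sub_le (ρ : ℝ) (x y : X) : |cutoff ρ x - cutoff ρ y| ≤ ‖x - y‖ := by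
  have h := abs_norm_sub_norm_le x y
  rw [abs_le] at h ⊢
  unfold cutoff
  rcases max_cases 0 (min 1 (ρ + 1 - ‖x‖)) with h1 | h1 <;>
  rcases max_cases 0 (min 1 (ρ + 1 - ‖y‖)) with h2 | h2 <;>
  rcases min_cases 1 (ρ + 1 - ‖x‖) with h3 | h3 <;>
  rcases min_cases 1 (ρ + 1 - ‖y‖) with h4 | h4 <;>
  constructor <;> linarith

/-- The truncation of a vector field to a ball. -/
def truncate (ρ : ℝ) (φ : X → X) (x : X) : X := cutoff ρ x • φ x

omit [NormedSpace ℝ X] in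
theorem exists_norm_le_of_lipschitzOnWith {φ : X → X} {K : ℝ≥0} {ρ : ℝ} (hρ : 0 ≤ ρ)
    (h : LipschitzOnWith K φ (Metric.closedBall 0 ρ)) :
    ∃ C : ℝ≥0, ∀ x, ‖x‖ ≤ ρ → ‖φ x‖ ≤ C := by
  refine ⟨⟨‖φ 0‖ + K * ρ, by positivity⟩, fun x hx => ?_⟩
  have h1 := h.norm_sub_le (mem_closedBall_zero_iff.mpr hx) (Metric.mem_closedBall_self hρ)
  rw [sub_zero] at h1
  calc ‖φ x‖ = ‖φ 0 + (φ x - φ 0)‖ := by rw [add_sub_cancel]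
    _ ≤ ‖φ 0‖ + K * ‖x‖ := (norm_add_le _ _).trans (by gcongr)
    _ ≤ ‖φ 0‖ + K * ρ := by gcongr

theorem exists_isSolution_truncate [CompleteSpace X] {φ : X → X} {K : ℝ≥0} {ρ : ℝ} (hρ : 0 ≤ ρ)
    (h : LipschitzOnWith K φ (Metric.closedBall 0 (ρ + 1))) (x₀ : X) (a : ℝ) :
    ∃ x, IsSolution (truncate ρ φ) x₀ a x := by
  obtain ⟨C, hC⟩ := exists_norm_le_of_lipschitzOnWith (by linarith) h
  have hbound : ∀ x, ‖truncate ρ φ x‖ ≤ C := by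
    intro x
    rw [truncate, norm_smul, Real.norm_eq_abs, abs_of_nonneg (cutoff_nonneg ρ x)]
    rcases le_total ‖x‖ (ρ + 1) with hx | hx
    · calc cutoff ρ x * ‖φ x‖ ≤ 1 * C :=
            mul_le_mul (cutoff_le_one ρ x) (hC x hx) (norm_nonneg _) zero_le_one
        _ = C := one_mul _
    · rw [cutoff_eq_zero hx, zero_mul]
      exact C.2
  -- Only x need lie in the larger ball: if y is outside, its cutoff vanishes and the term
  -- containing φ y drops out.
  have haux : ∀ x y, ‖x‖ ≤ ρ + 1 →
      ‖truncate ρ φ x - truncate ρ φ y‖ ≤ (C + K : ℝ≥0) * ‖x - y‖ := by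
    intro x y hx
    have h1 : ‖(cutoff ρ x - cutoff ρ y) • φ x‖ ≤ C * ‖x - y‖ := by
      rw [norm_smul, Real.norm_eq_abs, mul_comm]
      exact mul_le_mul (hC x hx) (abs_cutoff_sub_le ρ x y) (abs_nonneg _) C.2
    have h2 : ‖cutoff ρ y • (φ x - φ y)‖ ≤ K * ‖x - y‖ := by
      rw [norm_smul, Real.norm_eq_abs, abs_of_nonneg (cutoff_nonneg ρ y)]
      rcases le_total ‖y‖ (ρ + 1) with hy | hy
      · calc cutoff ρ y * ‖φ x - φ y‖ ≤ 1 * (K * ‖x - y‖) :=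
              mul_le_mul (cutoff_le_one ρ y)
                (h.norm_sub_le (mem_closedBall_zero_iff.mpr hx) (mem_closedBall_zero_iff.mpr hy))
                (norm_nonneg _) zero_le_one
          _ = _ := one_mul _
      · rw [cutoff_eq_zero hy, zero_mul]
        positivity
    have h3 : truncate ρ φ x - truncate ρ φ y =
        (cutoff ρ x - cutoff ρ y) • φ x + cutoff ρ y • (φ x - φ y) := by
      unfold truncate
      module
    rw [h3]
    refine (norm_add_le _ _).trans ?_
    push_cast
    linarith
  have hlip : LipschitzWith (C + K) (truncate ρ φ) := by
    refine LipschitzWith.of_dist_le_mul fun x y => ?_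
    rw [dist_eq_norm, dist_eq_norm]
    rcases le_total ‖x‖ (ρ + 1) with hx | hx
    · exact haux x y hx
    rcases le_total ‖y‖ (ρ + 1) with hy | hy
    · rw [norm_sub_rev, norm_sub_rev x]
      exact haux y x hy
    · rw [truncate, truncate, cutoff_eq_zero hx, cutoff_eq_zero hy, zero_smul, zero_smul,
        sub_self, norm_zero]
      positivity
  have ha : (0 : ℝ) ≤ max a 0 := le_max_right _ _
  -- A field bounded by C moves a point at most C times the elapsed time, so this radius allows the
  -- whole interval at once.
  have hpl : IsPicardLindelof (fun _ : ℝ => truncate ρ φ) (tmin := 0) (tmax := max a 0)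
      ⟨0, le_rfl, ha⟩ x₀ (C * ⟨max a 0, ha⟩) 0 C (C + K) := by
    refine IsPicardLindelof.of_time_independent (fun x _ => hbound x) hlip.lipschitzOnWith ?_
    simp only [sub_zero, sub_self, max_eq_left ha, NNReal.coe_zero]
    exact le_rfl
  obtain ⟨x, hx0, hx⟩ := hpl.exists_eq_forall_mem_Icc_hasDerivWithinAt₀
  refine ⟨x, hx0, fun t ht => (hx t ⟨ht.1, ht.2.le.trans (le_max_left _ _)⟩).mono ?_⟩
  exact fun s hs => ⟨hs.1, hs.2.le.trans (le_max_left _ _)⟩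

end Flow

/-! ### Barriers and global existence for the Riccati equation. -/

section RiccatiFlow

variable {𝕜 E : Type*} [RCLike 𝕜] [NormedAddCommGroup E] [InnerProductSpace 𝕜 E]
  [CompleteSpace E]

theorem exists_lipschitzOnWith_riccatiField (A : E →L[𝕜] E) (D S : SymOp 𝕜 E) (ρ : ℝ) :
    ∃ K : ℝ≥0, LipschitzOnWith K (riccatiField A D S) (Metric.closedBall 0 ρ) := by
  refine ⟨⟨2 * (‖A‖ + ‖S‖ * (|ρ| + |ρ|)), by positivity⟩,
    LipschitzOnWith.of_dist_le_mul fun P hP Q hQ => ?_⟩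
  have hP' : ‖P‖ ≤ |ρ| := (mem_closedBall_zero_iff.mp hP).trans (le_abs_self ρ)
  have hQ' : ‖Q‖ ≤ |ρ| := (mem_closedBall_zero_iff.mp hQ).trans (le_abs_self ρ)
  rw [dist_eq_norm, dist_eq_norm, riccatiField_sub]
  refine (norm_lyap_le _ _).trans ?_
  change _ ≤ 2 * (‖A‖ + ‖S‖ * (|ρ| + |ρ|)) * ‖P - Q‖
  gcongr
  exact (norm_closedLoop_le A S P Q).trans (by gcongr)

theorem SymOp.smul_nonneg {c : ℝ} (hc : 0 ≤ c) {P : SymOp 𝕜 E} (hP : 0 ≤ P) : 0 ≤ c • P :=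
  nonneg_iff_quad.mpr fun x => by
    rw [quad_smul]
    exact mul_nonneg hc (nonneg_iff_quad.mp hP x)

omit [CompleteSpace E] in
theorem norm_ofReal_smul_le {c L : ℝ} (h0 : 0 ≤ c) (h1 : c ≤ 1) {R : E →L[𝕜] E} (hR : ‖R‖ ≤ L) :
    ‖(c : 𝕜) • R‖ ≤ L := by
  rw [norm_smul, RCLike.norm_ofReal, abs_of_nonneg h0]
  exact (mul_le_of_le_one_left (norm_nonneg R) h1).trans hR

/-- The cutoff is a nonnegative scalar multiplying the whole field, so x - C still satisfies a
Lyapunov equation with nonnegative source. -/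
theorem IsSolution.ge_of_riccatiField_nonneg {A : E →L[𝕜] E} {D S C P : SymOp 𝕜 E} {ρ a : ℝ}
    {x : ℝ → SymOp 𝕜 E} (hx : IsSolution (truncate ρ (riccatiField A D S)) P a x)
    (hC : 0 ≤ riccatiField A D S C) (hP : C ≤ P) {t : ℝ} (ht : t ∈ Ico 0 a) : C ≤ x t := by
  have hxc := hx.continuousOn_Icc ht.2
  obtain ⟨B, hB⟩ := isCompact_Icc.exists_bound_of_continuousOn hxc
  refine nonneg_sub_iff.mp (nonneg_of_lyapunov (Z := fun s => x s - C)
    (L := ‖A‖ + ‖S‖ * (B + ‖C‖)) (hxc.sub continuousOn_const)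
    (nonneg_sub_iff.mpr (hx.1 ▸ hP)) (fun s hs => ?_) t ⟨ht.1, le_rfl⟩)
  refine ⟨((cutoff ρ (x s) : ℝ) : 𝕜) • closedLoop A S (x s) C,
    cutoff ρ (x s) • riccatiField A D S C,
    norm_ofReal_smul_le (cutoff_nonneg _ _) (cutoff_le_one _ _) ?_,
    SymOp.smul_nonneg (cutoff_nonneg _ _) hC, ?_⟩
  · refine (norm_closedLoop_le A S (x s) C).trans ?_
    have := hB s ⟨hs.1, hs.2.le⟩
    gcongr
  · rw [← smul_lyap, ← riccatiField_sub A D, ← smul_add, sub_add_cancel]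
    exact (hx.hasDerivWithinAt_Ici ⟨hs.1, hs.2.trans ht.2⟩).sub_const C

theorem IsSolution.le_of_riccatiField_nonpos {A : E →L[𝕜] E} {D S C P : SymOp 𝕜 E} {ρ a : ℝ}
    {x : ℝ → SymOp 𝕜 E} (hx : IsSolution (truncate ρ (riccatiField A D S)) P a x)
    (hC : riccatiField A D S C ≤ 0) (hP : P ≤ C) {t : ℝ} (ht : t ∈ Ico 0 a) : x t ≤ C := by
  have hxc := hx.continuousOn_Icc ht.2
  obtain ⟨B, hB⟩ := isCompact_Icc.exists_bound_of_continuousOn hxc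
  have hC' : 0 ≤ -riccatiField A D S C := by
    rw [le_iff_quad] at hC ⊢
    intro v
    have := hC v
    simp only [quad_zero, quad_neg] at this ⊢
    linarith
  refine nonneg_sub_iff.mp (nonneg_of_lyapunov (Z := fun s => C - x s)
    (L := ‖A‖ + ‖S‖ * (‖C‖ + B)) (continuousOn_const.sub hxc)
    (nonneg_sub_iff.mpr (hx.1 ▸ hP)) (fun s hs => ?_) t ⟨ht.1, le_rfl⟩)
  refine ⟨((cutoff ρ (x s) : ℝ) : 𝕜) • closedLoop A S C (x s),
    cutoff ρ (x s) • (-riccatiField A D S C),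
    norm_ofReal_smul_le (cutoff_nonneg _ _) (cutoff_le_one _ _) ?_,
    SymOp.smul_nonneg (cutoff_nonneg _ _) hC', ?_⟩
  · refine (norm_closedLoop_le A S C (x s)).trans ?_
    have := hB s ⟨hs.1, hs.2.le⟩
    gcongr
  · have h : riccatiField A D S C - riccatiField A D S (x s) + -riccatiField A D S C =
        -riccatiField A D S (x s) := by abel
    rw [← smul_lyap, ← riccatiField_sub A D, ← smul_add, h, smul_neg]
    exact (hx.hasDerivWithinAt_Ici ⟨hs.1, hs.2.trans ht.2⟩).const_sub C

/-- An order interval `[ε I, r I]` whose end points are a sub- and a supersolution of the algebraic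
Riccati equation is invariant, and the solutions starting in it are global. -/
theorem exists_isSolution_riccatiField {A : E →L[𝕜] E} {D S P : SymOp 𝕜 E} {ε r : ℝ} (hε : 0 ≤ ε)
    (hr : 0 ≤ r) (h₁ : 0 ≤ riccatiField A D S (ε • (1 : SymOp 𝕜 E)))
    (h₂ : riccatiField A D S (r • (1 : SymOp 𝕜 E)) ≤ 0) (hP₁ : ε • (1 : SymOp 𝕜 E) ≤ P)
    (hP₂ : P ≤ r • (1 : SymOp 𝕜 E)) (a : ℝ) :
    ∃ x, IsSolution (riccatiField A D S) P a x ∧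
      ∀ t ∈ Ico 0 a, ε • (1 : SymOp 𝕜 E) ≤ x t ∧ x t ≤ r • (1 : SymOp 𝕜 E) := by
  obtain ⟨K, hK⟩ := exists_lipschitzOnWith_riccatiField A D S (r + 1)
  obtain ⟨x, hx⟩ := exists_isSolution_truncate hr hK P a
  have hmem : ∀ t ∈ Ico 0 a, ε • (1 : SymOp 𝕜 E) ≤ x t ∧ x t ≤ r • (1 : SymOp 𝕜 E) := fun t ht =>
    ⟨hx.ge_of_riccatiField_nonneg h₁ hP₁ ht, hx.le_of_riccatiField_nonpos h₂ hP₂ ht⟩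
  refine ⟨x, ⟨hx.1, fun t ht => ?_⟩, hmem⟩
  have h3 : 0 ≤ ε • (1 : SymOp 𝕜 E) := SymOp.smul_nonneg hε (nonneg_iff_quad.mpr fun v => by
    rw [quad_one]; positivity)
  -- The barriers confine the truncated solution to the ball where the cutoff is 1, so it solves the
  -- original equation.
  have h4 := norm_le_of_nonneg_of_le hr (h3.trans (hmem t ht).1) (hmem t ht).2
  have h5 := hx.2 t ht
  rwa [truncate, cutoff_eq_one h4, one_smul] at h5

/-! ### Exponential contraction of order ratios. -/

theorem lyap_smul_right (c : ℝ) (R : E →L[𝕜] E) (W : SymOp 𝕜 E) :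
    lyap R (c • W) = c • lyap R W := by
  refine Subtype.ext ?_
  change star R * ((c : 𝕜) • (W : E →L[𝕜] E)) + ((c : 𝕜) • (W : E →L[𝕜] E)) * R =
    (c : 𝕜) • (star R * (W : E →L[𝕜] E) + W * R)
  simp only [smul_mul_assoc, mul_smul_comm, smul_add]

theorem lyap_sub_smul_one (c : ℝ) (R : E →L[𝕜] E) (W : SymOp 𝕜 E) :
    lyap (R - ((c / 2 : ℝ) : 𝕜) • 1) W = lyap R W - c • W := by
  refine Subtype.ext ?_
  change star (R - ((c / 2 : ℝ) : 𝕜) • 1) * (W : E →L[𝕜] E) +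
    (W : E →L[𝕜] E) * (R - ((c / 2 : ℝ) : 𝕜) • 1) =
    (star R * (W : E →L[𝕜] E) + W * R) - (c : 𝕜) • (W : E →L[𝕜] E)
  have h : (c : 𝕜) • (W : E →L[𝕜] E) =
      ((c / 2 : ℝ) : 𝕜) • (W : E →L[𝕜] E) + ((c / 2 : ℝ) : 𝕜) • (W : E →L[𝕜] E) := by
    rw [← add_smul, ← RCLike.ofReal_add, add_halves]
  rw [star_sub, star_ofReal_smul, star_one, h]
  simp only [sub_mul, mul_sub, smul_mul_assoc, mul_smul_comm, one_mul, mul_one]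
  abel

theorem riccatiField_eq (A : E →L[𝕜] E) (D S P : SymOp 𝕜 E) :
    riccatiField A D S P = lyap A P + D - sandwich P S :=
  Subtype.ext (by
    change _ = star A * (P : E →L[𝕜] E) + P * A + D - star (P : E →L[𝕜] E) * S * P
    rw [P.star_coe]
    rfl)

theorem sandwich_smul_smul (b c : ℝ) (P S : SymOp 𝕜 E) :
    sandwich ((b • P : SymOp 𝕜 E) : E →L[𝕜] E) (c • S) = (b ^ 2 * c) • sandwich P S := by
  refine Subtype.ext ?_
  change star ((b : 𝕜) • (P : E →L[𝕜] E)) * ((c : 𝕜) • (S : E →L[𝕜] E)) *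
    ((b : 𝕜) • (P : E →L[𝕜] E)) =
    ((b ^ 2 * c : ℝ) : 𝕜) • (star (P : E →L[𝕜] E) * (S : E →L[𝕜] E) * (P : E →L[𝕜] E))
  rw [star_ofReal_smul]
  simp only [smul_mul_assoc, mul_smul_comm, smul_smul]
  congr 1
  push_cast
  ring

theorem riccatiField_smul_one (A : E →L[𝕜] E) (D S : SymOp 𝕜 E) (c : ℝ) (v : E) :
    quad (riccatiField A D S (c • (1 : SymOp 𝕜 E))) v =
      c * quad (lyap A (1 : SymOp 𝕜 E)) v + quad D v - c ^ 2 * quad S v := by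
  have h := sandwich_smul_smul c 1 (1 : SymOp 𝕜 E) S
  rw [one_smul, mul_one] at h
  rw [riccatiField_eq, h, lyap_smul_right]
  simp [SymOp.coe_one]

/-- Scaling Q by μ and S by 1/μ turns the field into μφ(Q) + (1 - μ)D, so `riccatiField_sub` applies
to μQ and P. The shift by l/2 absorbs -l(μQ - P), leaving -lP in the source. -/
theorem smul_riccatiField_sub {A : E →L[𝕜] E} {D S P Q : SymOp 𝕜 E} {μ : ℝ} (hμ : μ ≠ 0) (l : ℝ) :
    μ • riccatiField A D S Q + (-(l * μ)) • Q - riccatiField A D S P =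
      lyap (closedLoop A (μ⁻¹ • S) (μ • Q) P - ((l / 2 : ℝ) : 𝕜) • 1) (μ • Q - P)
        + ((μ - 1) • D + (1 - μ⁻¹) • sandwich P S - l • P) := by
  have h1 := riccatiField_sub A D (μ⁻¹ • S) (μ • Q) P
  have h2 : riccatiField A D (μ⁻¹ • S) (μ • Q) = μ • riccatiField A D S Q + (1 - μ) • D := by
    rw [riccatiField_eq, riccatiField_eq, sandwich_smul_smul, lyap_smul_right,
      show μ ^ 2 * μ⁻¹ = μ by field_simp]
    module
  have h3 : riccatiField A D (μ⁻¹ • S) P =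
      riccatiField A D S P + (1 - μ⁻¹) • sandwich (P : E →L[𝕜] E) S := by
    have h := sandwich_smul_smul 1 μ⁻¹ P S
    rw [one_smul, one_pow, one_mul] at h
    rw [riccatiField_eq, riccatiField_eq, h]
    module
  rw [lyap_sub_smul_one, ← h1, h2, h3]
  module

/-- The bounds on D, S and P reduce the claim to 1 - 1/μ ≤ log μ ≤ μ - 1; `hαr` makes the
coefficients of log μ cancel. -/
theorem contraction_source_nonneg {D S P : SymOp 𝕜 E} {mD cS r μ α : ℝ} (hcS : 0 ≤ cS)
    (hD : mD • (1 : SymOp 𝕜 E) ≤ D) (hS : (-cS) • (1 : SymOp 𝕜 E) ≤ S) (hmD : 0 ≤ mD) (hr : 0 ≤ r)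
    (hα : 0 ≤ α) (hαr : α * r = mD - cS * r ^ 2) (hP₀ : 0 ≤ P) (hP : P ≤ r • (1 : SymOp 𝕜 E))
    (hμ : 1 ≤ μ) :
    0 ≤ (μ - 1) • D + (1 - μ⁻¹) • sandwich P S - (α * Real.log μ) • P := by
  have hμ0 : 0 < μ := one_pos.trans_le hμ
  have hl0 : 0 ≤ Real.log μ := Real.log_nonneg hμ
  have hl1 : Real.log μ ≤ μ - 1 := Real.log_le_sub_one_of_pos hμ0
  have hl2 : 1 - μ⁻¹ ≤ Real.log μ := Real.one_sub_inv_le_log_of_pos hμ0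
  have hinv : 0 ≤ 1 - μ⁻¹ := sub_nonneg.mpr (inv_le_one_of_one_le₀ hμ)
  have hn := norm_le_of_nonneg_of_le hr hP₀ hP
  refine nonneg_iff_quad.mpr fun v => ?_
  have h1 := le_iff_quad.mp hD v
  have h2 := le_iff_quad.mp hS ((P : E →L[𝕜] E) v)
  have h3 := le_iff_quad.mp hP v
  have h4 : ‖(P : E →L[𝕜] E) v‖ ^ 2 ≤ r ^ 2 * ‖v‖ ^ 2 := by
    rw [← mul_pow]
    gcongr
    exact ((P : E →L[𝕜] E).le_opNorm v).trans (by gcongr; exact hn)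
  simp only [quad_add, quad_sub, quad_smul, quad_one, quad_sandwich] at h1 h2 h3 ⊢
  have e1 := mul_le_mul_of_nonneg_left h1 (sub_nonneg.mpr hμ)
  have e2 : (1 - μ⁻¹) * (-cS * (r ^ 2 * ‖v‖ ^ 2)) ≤ (1 - μ⁻¹) * quad S ((P : E →L[𝕜] E) v) :=
    mul_le_mul_of_nonneg_left
      (by linarith [mul_le_mul_of_nonneg_left h4 hcS]) hinv
  have e3 := mul_le_mul_of_nonneg_left h3 (mul_nonneg hα hl0)
  have e4 : α * Real.log μ * (r * ‖v‖ ^ 2) = (mD - cS * r ^ 2) * Real.log μ * ‖v‖ ^ 2 := by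
    rw [← hαr]; ring
  have e5 : 0 ≤ mD * (μ - 1 - Real.log μ) * ‖v‖ ^ 2 :=
    mul_nonneg (mul_nonneg hmD (by linarith)) (sq_nonneg _)
  have e6 : 0 ≤ cS * r ^ 2 * (Real.log μ - (1 - μ⁻¹)) * ‖v‖ ^ 2 :=
    mul_nonneg (mul_nonneg (by positivity) (by linarith)) (sq_nonneg _)
  linarith

/-- The Riccati flow contracts order ratios exponentially. -/
theorem IsSolution.le_exp_smul {A : E →L[𝕜] E} {D S P Q : SymOp 𝕜 E} {mD cS r α s a : ℝ}
    {x y : ℝ → SymOp 𝕜 E} (hcS : 0 ≤ cS) (hD : mD • (1 : SymOp 𝕜 E) ≤ D)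
    (hS : (-cS) • (1 : SymOp 𝕜 E) ≤ S) (hmD : 0 ≤ mD) (hr : 0 ≤ r) (hα : 0 ≤ α)
    (hαr : α * r = mD - cS * r ^ 2) (hx : IsSolution (riccatiField A D S) P a x)
    (hy : IsSolution (riccatiField A D S) Q a y)
    (hmem : ∀ t ∈ Ico 0 a, 0 ≤ x t ∧ x t ≤ r • (1 : SymOp 𝕜 E)) (hs : 0 ≤ s)
    (hPQ : P ≤ Real.exp s • Q) {t : ℝ} (ht : t ∈ Ico 0 a) :
    x t ≤ Real.exp (Real.exp (-α * t) * s) • y t := by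
  -- Here log μ decays at rate α from s, hence μ' = -α μ log μ, the term supplied by
  -- `smul_riccatiField_sub` with l = α log μ.
  set μ : ℝ → ℝ := fun u => Real.exp (Real.exp (-α * u) * s) with hμ
  have hlog : ∀ u, Real.log (μ u) = Real.exp (-α * u) * s := fun u => Real.log_exp _
  have hμ1 : ∀ u, 1 ≤ μ u := fun u => Real.one_le_exp (by positivity)
  have hμd : ∀ u, HasDerivAt μ (-(α * Real.log (μ u) * μ u)) u := by
    intro u
    have h1 : HasDerivAt (fun u : ℝ => -α * u) (-α) u := by
      simpa using (hasDerivAt_id u).const_mul (-α)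
    have h2 := (h1.exp.mul_const s).exp
    convert h2 using 1
    rw [hlog]
    simp only [hμ]
    ring
  have hμc : Continuous μ := continuous_iff_continuousAt.mpr fun u => (hμd u).continuousAt
  have hxc := hx.continuousOn_Icc ht.2
  have hyc := hy.continuousOn_Icc ht.2
  have hμyc : ContinuousOn (fun u => μ u • y u) (Icc 0 t) := hμc.continuousOn.smul hyc
  obtain ⟨B₁, hB₁⟩ := isCompact_Icc.exists_bound_of_continuousOn hxc
  obtain ⟨B₂, hB₂⟩ := isCompact_Icc.exists_bound_of_continuousOn hμyc
  refine nonneg_sub_iff.mp (nonneg_of_lyapunov (Z := fun u => μ u • y u - x u)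
    (L := ‖A‖ + ‖S‖ * (B₂ + B₁) + α * s) (hμyc.sub hxc) ?_ (fun u hu => ?_) t ⟨ht.1, le_rfl⟩)
  · rw [nonneg_sub_iff, hx.1, hy.1]
    simpa [hμ] using hPQ
  have hu' : u ∈ Ico 0 a := ⟨hu.1, hu.2.trans ht.2⟩
  have hμ0 : 0 < μ u := one_pos.trans_le (hμ1 u)
  refine ⟨closedLoop A ((μ u)⁻¹ • S) (μ u • y u) (x u) -
    ((α * Real.log (μ u) / 2 : ℝ) : 𝕜) • 1, _, ?_, contraction_source_nonneg hcS hD hS hmD hr hα hαr (hmem u hu').1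
    (hmem u hu').2 (hμ1 u), ?_⟩
  · refine (norm_sub_le _ _).trans (add_le_add ((norm_closedLoop_le _ _ _ _).trans ?_) ?_)
    · have h1 := hB₁ u ⟨hu.1, hu.2.le⟩
      have h2 := hB₂ u ⟨hu.1, hu.2.le⟩
      have h3 : ‖(μ u)⁻¹ • S‖ ≤ ‖S‖ := by
        rw [norm_smul, Real.norm_eq_abs, abs_of_pos (inv_pos.mpr hμ0)]
        exact mul_le_of_le_one_left (norm_nonneg _) (inv_le_one_of_one_le₀ (hμ1 u))
      gcongr
    · have h4 : Real.exp (-α * u) ≤ 1 := Real.exp_le_one_iff.mpr (by nlinarith [hu.1])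
      have h5 : Real.exp (-α * u) * s ≤ s := mul_le_of_le_one_left hs h4
      have h6 : 0 ≤ Real.exp (-α * u) * s := by positivity
      rw [norm_smul, RCLike.norm_ofReal, hlog, abs_of_nonneg (by positivity)]
      calc _ ≤ α * (Real.exp (-α * u) * s) / 2 * 1 := by
            gcongr
            exact ContinuousLinearMap.norm_id_le
        _ ≤ α * (Real.exp (-α * u) * s) := by linarith [mul_nonneg hα h6]
        _ ≤ α * s := by gcongr
  · rw [← smul_riccatiField_sub hμ0.ne']
    exact ((hμd u).hasDerivWithinAt.smul (hy.hasDerivWithinAt_Ici hu')).sub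
      (hx.hasDerivWithinAt_Ici hu')

end RiccatiFlow

/-! ### Order ratios and the Thompson metric. -/

section ThompsonMetric

variable {𝕜 E : Type*} [RCLike 𝕜] [NormedAddCommGroup E] [InnerProductSpace 𝕜 E]
  [CompleteSpace E]

theorem smul_one_mono {a b : ℝ} (h : a ≤ b) : a • (1 : SymOp 𝕜 E) ≤ b • (1 : SymOp 𝕜 E) :=
  le_iff_quad.mpr fun x => by
    rw [quad_smul, quad_smul, quad_one]
    gcongr

theorem le_norm_smul_one (P : SymOp 𝕜 E) : P ≤ ‖P‖ • (1 : SymOp 𝕜 E) :=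
  le_iff_quad.mpr fun x => by
    rw [quad_smul, quad_one]
    exact (le_abs_self _).trans (abs_quad_le P x)

theorem quad_pos_of_smul_one_le {P : SymOp 𝕜 E} {ε : ℝ} (hε : 0 < ε)
    (hP : ε • (1 : SymOp 𝕜 E) ≤ P) {v : E} (hv : v ≠ 0) : 0 < quad P v := by
  have h := le_iff_quad.mp hP v
  rw [quad_smul, quad_one] at h
  exact lt_of_lt_of_le (by have := norm_pos_iff.mpr hv; positivity) h

theorem nonneg_of_smul_one_le {P : SymOp 𝕜 E} {ε : ℝ} (hε : 0 ≤ ε)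
    (hP : ε • (1 : SymOp 𝕜 E) ≤ P) : 0 ≤ P :=
  (SymOp.smul_nonneg hε (nonneg_iff_quad.mpr fun v => by rw [quad_one]; positivity)).trans hP

theorem le_smul_of_bounds {P Q : SymOp 𝕜 E} {ε r : ℝ} (hε : 0 < ε) (hr : 0 ≤ r)
    (hP : P ≤ r • (1 : SymOp 𝕜 E)) (hQ : ε • (1 : SymOp 𝕜 E) ≤ Q) : P ≤ (r / ε) • Q :=
  le_iff_quad.mpr fun v => by
    have h1 := le_iff_quad.mp hP v
    have h2 := le_iff_quad.mp hQ v
    rw [quad_smul, quad_one] at h1 h2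
    rw [quad_smul]
    calc quad P v ≤ r * ‖v‖ ^ 2 := h1
      _ = r / ε * (ε * ‖v‖ ^ 2) := by field_simp
      _ ≤ _ := by gcongr

theorem le_maxRatio_smul {P Q : SymOp 𝕜 E} {ε : ℝ} (hε : 0 < ε)
    (hQ : ε • (1 : SymOp 𝕜 E) ≤ Q) : P ≤ maxRatio P Q • Q := by
  refine le_iff_quad.mpr fun v => ?_
  rw [quad_smul]
  rcases eq_or_ne v 0 with rfl | hv
  · simp [quad]
  have hv' := quad_pos_of_smul_one_le hε hQ hv
  rw [← div_le_iff₀ hv']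
  refine le_csInf ⟨‖P‖ / ε, le_smul_of_bounds hε (norm_nonneg P) (le_norm_smul_one P) hQ⟩ ?_
  intro t ht
  rw [div_le_iff₀ hv', ← quad_smul]
  exact le_iff_quad.mp ht v

theorem maxRatio_le [Nontrivial E] {P Q : SymOp 𝕜 E} {ε t : ℝ} (hε : 0 < ε)
    (hP : ε • (1 : SymOp 𝕜 E) ≤ P) (hQ : ε • (1 : SymOp 𝕜 E) ≤ Q) (h : P ≤ t • Q) :
    maxRatio P Q ≤ t := by
  obtain ⟨v, hv⟩ := exists_ne (0 : E)
  refine csInf_le ⟨0, fun s hs => ?_⟩ h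
  have h1 := le_iff_quad.mp hs v
  rw [quad_smul] at h1
  exact (pos_of_mul_pos_left ((quad_pos_of_smul_one_le hε hP hv).trans_le h1)
    (quad_pos_of_smul_one_le hε hQ hv).le).le

theorem SymOp.smul_le_smul_right {P : SymOp 𝕜 E} (hP : 0 ≤ P) {a b : ℝ} (h : a ≤ b) :
    a • P ≤ b • P :=
  le_iff_quad.mpr fun v => by
    rw [quad_smul, quad_smul]
    exact mul_le_mul_of_nonneg_right h (nonneg_iff_quad.mp hP v)

/-- If both ratios were below 1, a nonzero vector would give ⟨Pv, v⟩ < ⟨Qv, v⟩ < ⟨Pv, v⟩. -/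
theorem one_le_max_maxRatio [Nontrivial E] {P Q : SymOp 𝕜 E} {ε : ℝ} (hε : 0 < ε)
    (hP : ε • (1 : SymOp 𝕜 E) ≤ P) (hQ : ε • (1 : SymOp 𝕜 E) ≤ Q) :
    1 ≤ max (maxRatio P Q) (maxRatio Q P) := by
  obtain ⟨v, hv⟩ := exists_ne (0 : E)
  have hp := quad_pos_of_smul_one_le hε hP hv
  have hq := quad_pos_of_smul_one_le hε hQ hv
  set m := max (maxRatio P Q) (maxRatio Q P)
  have h1 : quad P v ≤ m * quad Q v :=
    (le_iff_quad.mp (le_maxRatio_smul hε hQ) v).trans (by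
      rw [quad_smul]; gcongr; exact le_max_left _ _)
  have h2 : quad Q v ≤ m * quad P v :=
    (le_iff_quad.mp (le_maxRatio_smul hε hP) v).trans (by
      rw [quad_smul]; gcongr; exact le_max_right _ _)
  by_contra! hm
  have h3 := mul_lt_mul_of_pos_right hm hq
  have h4 := mul_lt_mul_of_pos_right hm hp
  linarith

theorem eq_of_subsingleton [Subsingleton E] (P Q : SymOp 𝕜 E) : P = Q :=
  Subtype.ext (ContinuousLinearMap.ext fun _ => Subsingleton.elim _ _)

theorem thompsonDist_comm (P Q : SymOp 𝕜 E) : thompsonDist P Q = thompsonDist Q P := by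
  rw [thompsonDist, thompsonDist, max_comm]

theorem thompsonDist_nonneg {P Q : SymOp 𝕜 E} {ε : ℝ} (hε : 0 < ε)
    (hP : ε • (1 : SymOp 𝕜 E) ≤ P) (hQ : ε • (1 : SymOp 𝕜 E) ≤ Q) : 0 ≤ thompsonDist P Q := by
  rcases subsingleton_or_nontrivial E with hE | hE
  -- On the zero space the infimum over all reals is 0 by convention and log 0 = 0, so the distance
  -- is 0.
  · have h : {t : ℝ | P ≤ t • Q} = univ := eq_univ_of_forall fun t => (eq_of_subsingleton _ _).le
    have h' : {t : ℝ | Q ≤ t • P} = univ := eq_univ_of_forall fun t => (eq_of_subsingleton _ _).le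
    simp [thompsonDist, maxRatio, h, h']
  · exact Real.log_nonneg (one_le_max_maxRatio hε hP hQ)

theorem le_exp_thompsonDist_smul {P Q : SymOp 𝕜 E} {ε : ℝ} (hε : 0 < ε)
    (hP : ε • (1 : SymOp 𝕜 E) ≤ P) (hQ : ε • (1 : SymOp 𝕜 E) ≤ Q) :
    P ≤ Real.exp (thompsonDist P Q) • Q := by
  rcases subsingleton_or_nontrivial E with hE | hE
  · exact (eq_of_subsingleton _ _).le
  · rw [thompsonDist, Real.exp_log (one_pos.trans_le (one_le_max_maxRatio hε hP hQ))]
    exact (le_maxRatio_smul hε hQ).trans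
      (SymOp.smul_le_smul_right (nonneg_of_smul_one_le hε.le hQ) (le_max_left _ _))

theorem thompsonDist_le {P Q : SymOp 𝕜 E} {ε s : ℝ} (hε : 0 < ε)
    (hP : ε • (1 : SymOp 𝕜 E) ≤ P) (hQ : ε • (1 : SymOp 𝕜 E) ≤ Q) (hs : 0 ≤ s)
    (hPQ : P ≤ Real.exp s • Q) (hQP : Q ≤ Real.exp s • P) : thompsonDist P Q ≤ s := by
  rcases subsingleton_or_nontrivial E with hE | hE
  · have h : {t : ℝ | P ≤ t • Q} = univ := eq_univ_of_forall fun t => (eq_of_subsingleton _ _).le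
    have h' : {t : ℝ | Q ≤ t • P} = univ := eq_univ_of_forall fun t => (eq_of_subsingleton _ _).le
    simpa [thompsonDist, maxRatio, h, h'] using hs
  · rw [thompsonDist, Real.log_le_iff_le_exp (one_pos.trans_le (one_le_max_maxRatio hε hP hQ))]
    exact max_le (maxRatio_le hε hP hQ hPQ) (maxRatio_le hε hQ hP hQP)

theorem norm_sub_le_of_le_smul {P Q : SymOp 𝕜 E} {μ r : ℝ} (hμ : 1 ≤ μ) (hr : 0 ≤ r)
    (hP : P ≤ r • (1 : SymOp 𝕜 E)) (hQ : Q ≤ r • (1 : SymOp 𝕜 E)) (hPQ : P ≤ μ • Q)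
    (hQP : Q ≤ μ • P) : ‖P - Q‖ ≤ (μ - 1) * r := by
  refine norm_le_of_abs_quad_le (mul_nonneg (by linarith) hr) fun v => ?_
  have h1 := le_iff_quad.mp hP v
  have h2 := le_iff_quad.mp hQ v
  have h3 := le_iff_quad.mp hPQ v
  have h4 := le_iff_quad.mp hQP v
  simp only [quad_smul, quad_one] at h1 h2 h3 h4
  have h5 := mul_le_mul_of_nonneg_left h1 (sub_nonneg.mpr hμ)
  have h6 := mul_le_mul_of_nonneg_left h2 (sub_nonneg.mpr hμ)
  rw [quad_sub, abs_le]
  constructor <;> linarith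

/-- This presents the set as a union of order intervals [εI, rI], the sets for which invariance is
proved. -/
theorem mem_posUpTo_iff {P : SymOp 𝕜 E} {r : ℝ} :
    P ∈ posUpTo 𝕜 E r ↔ (∃ ε : ℝ, 0 < ε ∧ ε • (1 : SymOp 𝕜 E) ≤ P) ∧ P ≤ r • (1 : SymOp 𝕜 E) := by
  constructor
  · rintro ⟨h1, h2, h3⟩
    exact ⟨exists_smul_one_le_of_isUnit ((isPositive_coe_iff_nonneg P).mp h1) h2, h3⟩
  · rintro ⟨⟨ε, hε, h1⟩, h2⟩
    exact ⟨(isPositive_coe_iff_nonneg P).mpr (nonneg_of_smul_one_le hε.le h1),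
      isUnit_of_smul_one_le hε h1, h2⟩

end ThompsonMetric

/-! ### Scalar sub- and supersolutions. -/

section Equilibrium

variable {𝕜 E : Type*} [RCLike 𝕜] [NormedAddCommGroup E] [InnerProductSpace 𝕜 E]
  [CompleteSpace E]

theorem continuous_riccatiField (A : E →L[𝕜] E) (D S : SymOp 𝕜 E) :
    Continuous (riccatiField A D S) := by
  refine continuous_iff_continuousAt.mpr fun P => ?_
  obtain ⟨K, hK⟩ := exists_lipschitzOnWith_riccatiField A D S (‖P‖ + 1)
  exact hK.continuousOn.continuousAt (Metric.closedBall_mem_nhds_of_mem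
    (mem_ball_zero_iff.mpr (by linarith)))

/-- The form of the field at rI is at most the quadratic polynomial times ‖v‖². A nonzero v forces
mD ≤ cD, which may fail on the zero space; hence the conditional form of `h`. -/
theorem riccatiField_smul_one_nonpos {A : E →L[𝕜] E} {D S : SymOp 𝕜 E} {cA cD mD cS r : ℝ}
    (hr : 0 ≤ r) (hA : lyap A (1 : SymOp 𝕜 E) ≤ (-(2 * cA)) • (1 : SymOp 𝕜 E))
    (hD₁ : mD • (1 : SymOp 𝕜 E) ≤ D) (hD₂ : D ≤ cD • (1 : SymOp 𝕜 E))
    (hS : (-cS) • (1 : SymOp 𝕜 E) ≤ S) (h : mD ≤ cD → cS * r ^ 2 - 2 * cA * r + cD ≤ 0) :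
    riccatiField A D S (r • (1 : SymOp 𝕜 E)) ≤ 0 := by
  refine le_iff_quad.mpr fun v => ?_
  rcases eq_or_ne v 0 with rfl | hv
  · simp [quad]
  have hv' : 0 < ‖v‖ ^ 2 := by have := norm_pos_iff.mpr hv; positivity
  have h1 := le_iff_quad.mp hA v
  have h2 := le_iff_quad.mp hD₁ v
  have h3 := le_iff_quad.mp hD₂ v
  have h4 := le_iff_quad.mp hS v
  rw [riccatiField_smul_one, quad_zero]
  simp only [quad_smul, quad_one] at h1 h2 h3 h4
  have h5 := mul_nonpos_of_nonpos_of_nonneg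
    (h (le_of_mul_le_mul_right (h2.trans h3) hv')) hv'.le
  have h6 := mul_le_mul_of_nonneg_left h1 hr
  have h7 := mul_le_mul_of_nonneg_left h4 (sq_nonneg r)
  linarith

/-- As ε tends to 0 the field at εI tends to D ≥ mD I; the cap ε ≤ 1 lets ε² be replaced by ε. -/
theorem exists_riccatiField_smul_one_nonneg (A : E →L[𝕜] E) {D : SymOp 𝕜 E} (S : SymOp 𝕜 E)
    {mD : ℝ} (hmD : 0 < mD) (hD : mD • (1 : SymOp 𝕜 E) ≤ D) :
    ∃ ε₀ : ℝ, 0 < ε₀ ∧ ∀ ε : ℝ, 0 ≤ ε → ε ≤ ε₀ →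
      0 ≤ riccatiField A D S (ε • (1 : SymOp 𝕜 E)) := by
  set N := ‖lyap A (1 : SymOp 𝕜 E)‖ + ‖S‖ + 1 with hN
  have hN0 : 0 < N := by positivity
  refine ⟨min 1 (mD / N), by positivity, fun ε h0 h1 => nonneg_iff_quad.mpr fun v => ?_⟩
  have hε1 : ε ≤ 1 := h1.trans (min_le_left _ _)
  have hε2 : ε * N ≤ mD := (le_div_iff₀ hN0).mp (h1.trans (min_le_right _ _))
  have h2 := le_iff_quad.mp hD v
  have h3 := (abs_le.mp (abs_quad_le (lyap A (1 : SymOp 𝕜 E)) v)).1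
  have h4 := (abs_le.mp (abs_quad_le S v)).2
  rw [riccatiField_smul_one]
  simp only [quad_smul, quad_one] at h2
  have h5 := mul_le_mul_of_nonneg_left h3 h0
  have h6 := mul_le_mul_of_nonneg_left h4 (sq_nonneg ε)
  have h7 : ε ^ 2 * (‖S‖ * ‖v‖ ^ 2) ≤ ε * (‖S‖ * ‖v‖ ^ 2) := by
    gcongr
    nlinarith
  have h8 := mul_le_mul_of_nonneg_right hε2 (sq_nonneg ‖v‖)
  have h9 : 0 ≤ ε * ‖v‖ ^ 2 := by positivity
  rw [hN] at h8
  linarith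

end Equilibrium

/-! ### Contraction of the flow and the equilibrium. -/

section MainResult

variable {𝕜 E : Type*} [RCLike 𝕜] [NormedAddCommGroup E] [InnerProductSpace 𝕜 E]
  [CompleteSpace E]

theorem exists_flow_bounds {A : E →L[𝕜] E} {D S P : SymOp 𝕜 E} {mD r : ℝ} (hmD : 0 < mD)
    (hD : mD • (1 : SymOp 𝕜 E) ≤ D) (hr : 0 ≤ r)
    (hsup : riccatiField A D S (r • (1 : SymOp 𝕜 E)) ≤ 0) (hP : P ∈ posUpTo 𝕜 E r) :
    (∀ a : ℝ, IsSolution (riccatiField A D S) P a fun t => flow (riccatiField A D S) t P) ∧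
      ∃ ε : ℝ, 0 < ε ∧ ε • (1 : SymOp 𝕜 E) ≤ P ∧ ∀ t : ℝ, 0 ≤ t →
        ε • (1 : SymOp 𝕜 E) ≤ flow (riccatiField A D S) t P ∧
        flow (riccatiField A D S) t P ≤ r • (1 : SymOp 𝕜 E) := by
  obtain ⟨⟨ε₁, hε₁, hP₁⟩, hP₂⟩ := mem_posUpTo_iff.mp hP
  obtain ⟨ε₀, hε₀, hsub⟩ := exists_riccatiField_smul_one_nonneg A S hmD hD
  have hε : 0 < min ε₁ ε₀ := lt_min hε₁ hε₀
  have hP₁' := (smul_one_mono (𝕜 := 𝕜) (E := E) (min_le_left ε₁ ε₀)).trans hP₁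
  have hex := exists_isSolution_riccatiField hε.le hr (hsub _ hε.le (min_le_right _ _)) hsup hP₁'
    hP₂
  have hlip := exists_lipschitzOnWith_riccatiField A D S
  refine ⟨isSolution_flow hlip fun a => (hex a).imp fun _ h => h.1, _, hε, hP₁', fun t ht => ?_⟩
  obtain ⟨x, hx, hb⟩ := hex (t + 1)
  have ht' : t ∈ Ico 0 (t + 1) := ⟨ht, by linarith⟩
  rw [← hx.eq_flow hlip ht']
  exact hb t ht'

/-- The Riccati flow is an exponential contraction for the Thompson metric. -/
theorem thompsonDist_flow_le {A : E →L[𝕜] E} {D S P Q : SymOp 𝕜 E} {mD cS r α t : ℝ}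
    (hmD : 0 < mD) (hcS : 0 ≤ cS) (hD : mD • (1 : SymOp 𝕜 E) ≤ D)
    (hS : (-cS) • (1 : SymOp 𝕜 E) ≤ S) (hr : 0 ≤ r)
    (hsup : riccatiField A D S (r • (1 : SymOp 𝕜 E)) ≤ 0) (hα : 0 ≤ α)
    (hαr : α * r = mD - cS * r ^ 2) (hP : P ∈ posUpTo 𝕜 E r) (hQ : Q ∈ posUpTo 𝕜 E r)
    (ht : 0 ≤ t) :
    thompsonDist (flow (riccatiField A D S) t P) (flow (riccatiField A D S) t Q)
      ≤ Real.exp (-α * t) * thompsonDist P Q := by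
  obtain ⟨hPs, ε₁, hε₁, hP₁, hPb⟩ := exists_flow_bounds hmD hD hr hsup hP
  obtain ⟨hQs, ε₂, hε₂, hQ₁, hQb⟩ := exists_flow_bounds hmD hD hr hsup hQ
  have hε : 0 < min ε₁ ε₂ := lt_min hε₁ hε₂
  have m₁ := smul_one_mono (𝕜 := 𝕜) (E := E) (min_le_left ε₁ ε₂)
  have m₂ := smul_one_mono (𝕜 := 𝕜) (E := E) (min_le_right ε₁ ε₂)
  have hs := thompsonDist_nonneg hε (m₁.trans hP₁) (m₂.trans hQ₁)
  have ht' : t ∈ Ico 0 (t + 1) := ⟨ht, by linarith⟩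
  refine thompsonDist_le hε (m₁.trans (hPb t ht).1) (m₂.trans (hQb t ht).1) (by positivity) ?_ ?_
  · exact (hPs (t + 1)).le_exp_smul hcS hD hS hmD.le hr hα hαr (hQs (t + 1))
      (fun u hu => ⟨nonneg_of_smul_one_le hε₁.le (hPb u hu.1).1, (hPb u hu.1).2⟩) hs
      (le_exp_thompsonDist_smul hε (m₁.trans hP₁) (m₂.trans hQ₁)) ht'
  · refine (hQs (t + 1)).le_exp_smul hcS hD hS hmD.le hr hα hαr (hPs (t + 1))
      (fun u hu => ⟨nonneg_of_smul_one_le hε₂.le (hQb u hu.1).1, (hQb u hu.1).2⟩) hs ?_ ht'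
    rw [thompsonDist_comm]
    exact le_exp_thompsonDist_smul hε (m₂.trans hQ₁) (m₁.trans hP₁)

theorem exists_equilibrium {A : E →L[𝕜] E} {D S : SymOp 𝕜 E} {mD cS r α : ℝ}
    (hmD : 0 < mD) (hcS : 0 ≤ cS) (hD : mD • (1 : SymOp 𝕜 E) ≤ D)
    (hS : (-cS) • (1 : SymOp 𝕜 E) ≤ S) (hr : 0 < r)
    (hsup : riccatiField A D S (r • (1 : SymOp 𝕜 E)) ≤ 0) (hα : 0 < α)
    (hαr : α * r = mD - cS * r ^ 2) :
    ∃ P ∈ posUpTo 𝕜 E r, riccatiField A D S P = 0 := by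
  have hP : r • (1 : SymOp 𝕜 E) ∈ posUpTo 𝕜 E r := mem_posUpTo_iff.mpr ⟨⟨r, hr, le_rfl⟩, le_rfl⟩
  obtain ⟨hs, ε, hε, hP₁, hb⟩ := exists_flow_bounds hmD hD hr.le hsup hP
  set P : SymOp 𝕜 E := r • (1 : SymOp 𝕜 E) with hPdef
  set x : ℝ → SymOp 𝕜 E := fun t => flow (riccatiField A D S) t P with hx
  -- A uniform bound for the logarithms of all ratios inside [εI, rI]; the absolute value keeps it
  -- nonnegative even on the zero space, where ε may exceed r.
  set s := |Real.log (r / ε)| with hsdef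
  have hes : r / ε ≤ Real.exp s := by
    rw [← Real.log_le_iff_le_exp (by positivity)]
    exact le_abs_self _
  have hpos : ∀ t, 0 ≤ t → 0 ≤ x t ∧ x t ≤ P := fun t ht =>
    ⟨nonneg_of_smul_one_le hε.le (hb t ht).1, (hb t ht).2⟩
  have hratio : ∀ X Y : SymOp 𝕜 E, X ≤ P → ε • (1 : SymOp 𝕜 E) ≤ Y → X ≤ Real.exp s • Y :=
    fun X Y hX hY => (le_smul_of_bounds hε hr.le hX hY).trans
      (SymOp.smul_le_smul_right (nonneg_of_smul_one_le hε.le hY) hes)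
  -- The shifted orbit is the solution from x(h). Contracting its ratio to the orbit from rI gives a
  -- bound independent of h, and on operators below rI a ratio near 1 means a small norm difference.
  have hstep : ∀ t h, 0 ≤ t → 0 ≤ h →
      ‖x (t + h) - x t‖ ≤ (Real.exp (Real.exp (-α * t) * s) - 1) * r := by
    intro t h ht hh
    have hx0 : x 0 = P := (hs 1).1
    have hsol := hs (t + 1)
    have hsol' : IsSolution (riccatiField A D S) (x h) (t + 1) fun u => x (u + h) := by
      have := (hs (t + 1 + h)).shift hh
      rwa [add_sub_cancel_right] at this
    have ht' : t ∈ Ico 0 (t + 1) := ⟨ht, by linarith⟩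
    refine norm_sub_le_of_le_smul (Real.one_le_exp (by positivity)) hr.le
      (hb _ (add_nonneg ht hh)).2 (hb t ht).2 ?_ ?_
    · exact hsol'.le_exp_smul hcS hD hS hmD.le hr.le hα.le hαr hsol
        (fun u hu => hpos _ (add_nonneg hu.1 hh)) (abs_nonneg _)
        (hratio _ _ (hb h hh).2 hP₁) ht'
    · exact hsol.le_exp_smul hcS hD hS hmD.le hr.le hα.le hαr hsol'
        (fun u hu => hpos _ hu.1) (abs_nonneg _) (hratio _ _ le_rfl (hb h hh).1) ht'
  have hlim : Tendsto (fun t => (Real.exp (Real.exp (-α * t) * s) - 1) * r) atTop (𝓝 0) := by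
    have h1 : Tendsto (fun t => Real.exp (-α * t)) atTop (𝓝 0) :=
      Real.tendsto_exp_atBot.comp (tendsto_id.const_mul_atTop_of_neg (neg_lt_zero.mpr hα))
    have h2 := (((Real.continuous_exp.tendsto _).comp (h1.mul_const s)).sub_const 1).mul_const r
    simpa [Function.comp_def] using h2
  have hcauchy : CauchySeq x := by
    refine Metric.cauchySeq_iff'.mpr fun δ hδ => ?_
    obtain ⟨T, hT, hT0⟩ := ((hlim.eventually_lt_const hδ).and (eventually_ge_atTop 0)).exists
    refine ⟨T, fun t ht => ?_⟩
    have h1 := hstep T (t - T) hT0 (sub_nonneg.mpr ht)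
    rw [add_sub_cancel] at h1
    rw [dist_eq_norm]
    exact h1.trans_lt hT
  obtain ⟨Y, hY⟩ := cauchySeq_tendsto_of_complete hcauchy
  have hYb : ε • (1 : SymOp 𝕜 E) ≤ Y ∧ Y ≤ P :=
    (isClosed_Icc_symOp _ _).mem_of_tendsto hY <|
      (eventually_ge_atTop 0).mono fun t ht => hb t ht
  exact ⟨Y, mem_posUpTo_iff.mpr ⟨⟨ε, hε, hYb.1⟩, hYb.2⟩,
    eq_zero_of_tendsto hs hY (continuous_riccatiField A D S).continuousAt⟩

theorem flow_eq_self {A : E →L[𝕜] E} {D S P : SymOp 𝕜 E} (h : riccatiField A D S P = 0) {t : ℝ}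
    (ht : 0 ≤ t) : flow (riccatiField A D S) t P = P :=
  ((isSolution_const h (t + 1)).eq_flow (exists_lipschitzOnWith_riccatiField A D S)
    ⟨ht, by linarith⟩).symm

theorem equilibrium_unique {A : E →L[𝕜] E} {D S P Q : SymOp 𝕜 E} {mD cS r α : ℝ}
    (hmD : 0 < mD) (hcS : 0 ≤ cS) (hD : mD • (1 : SymOp 𝕜 E) ≤ D)
    (hS : (-cS) • (1 : SymOp 𝕜 E) ≤ S) (hr : 0 ≤ r)
    (hsup : riccatiField A D S (r • (1 : SymOp 𝕜 E)) ≤ 0) (hα : 0 < α)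
    (hαr : α * r = mD - cS * r ^ 2) (hP : P ∈ posUpTo 𝕜 E r) (hQ : Q ∈ posUpTo 𝕜 E r)
    (hP₀ : riccatiField A D S P = 0) (hQ₀ : riccatiField A D S Q = 0) : P = Q := by
  have h := thompsonDist_flow_le hmD hcS hD hS hr hsup hα.le hαr hP hQ zero_le_one
  rw [flow_eq_self hP₀ zero_le_one, flow_eq_self hQ₀ zero_le_one] at h
  obtain ⟨⟨ε₁, hε₁, hP₁⟩, -⟩ := mem_posUpTo_iff.mp hP
  obtain ⟨⟨ε₂, hε₂, hQ₁⟩, -⟩ := mem_posUpTo_iff.mp hQ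
  have hε : 0 < min ε₁ ε₂ := lt_min hε₁ hε₂
  have hP₁' := (smul_one_mono (𝕜 := 𝕜) (E := E) (min_le_left ε₁ ε₂)).trans hP₁
  have hQ₁' := (smul_one_mono (𝕜 := 𝕜) (E := E) (min_le_right ε₁ ε₂)).trans hQ₁
  have h1 : Real.exp (-α * 1) < 1 := Real.exp_lt_one_iff.mpr (by linarith)
  have h2 := thompsonDist_nonneg hε hP₁' hQ₁'
  -- Equilibria do not move, so their distance is at most itself times a factor below 1.
  have h3 : thompsonDist P Q = 0 := by nlinarith
  have h4 := le_exp_thompsonDist_smul hε hP₁' hQ₁'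
  have h5 := le_exp_thompsonDist_smul hε hQ₁' hP₁'
  rw [thompsonDist_comm, h3, Real.exp_zero, one_smul] at h5
  rw [h3, Real.exp_zero, one_smul] at h4
  exact le_antisymm h4 h5

end MainResult

end Riccati

end

theorem mainTheorem11 {𝕜 E : Type*} [RCLike 𝕜] [NormedAddCommGroup E] [InnerProductSpace 𝕜 E]
    [CompleteSpace E]
    (A : E →L[𝕜] E) (D S : Riccati.SymOp 𝕜 E) (cA cD mD cS : ℝ)
    (hcA : 0 < cA) (hcD : 0 < cD) (hmD : 0 < mD) (hcS : 0 < cS)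
    (hA : A + star A ≤ (((-(2 * cA)) • (1 : Riccati.SymOp 𝕜 E) : Riccati.SymOp 𝕜 E) : E →L[𝕜] E))
    (hD_lower : mD • (1 : Riccati.SymOp 𝕜 E) ≤ D)
    (hD_upper : D ≤ cD • (1 : Riccati.SymOp 𝕜 E))
    (hS : (-cS) • (1 : Riccati.SymOp 𝕜 E) ≤ S)
    (h1 : cD * cS ≤ cA ^ 2)
    (h2 : (cA - Real.sqrt (cA ^ 2 - cD * cS)) ^ 2 < cS * mD)
    (r : ℝ)
    (hr : r ∈ Set.Ico ((cA - Real.sqrt (cA ^ 2 - cD * cS)) / cS) (Real.sqrt (mD / cS))) :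
    -- the maximal solution from each point of `(0, r I]` is unique, global, and stays there
    (∀ P ∈ Riccati.posUpTo 𝕜 E r,
      (∀ a : ℝ, Riccati.IsSolution (Riccati.riccatiField A D S) P a
        (fun t => Riccati.flow (Riccati.riccatiField A D S) t P)) ∧
      (∀ (a : ℝ) (x : ℝ → Riccati.SymOp 𝕜 E),
        Riccati.IsSolution (Riccati.riccatiField A D S) P a x →
        ∀ t ∈ Set.Ico 0 a, x t = Riccati.flow (Riccati.riccatiField A D S) t P) ∧
      ∀ t : ℝ, 0 ≤ t →
        Riccati.flow (Riccati.riccatiField A D S) t P ∈ Riccati.posUpTo 𝕜 E r) ∧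
    ∃ α : ℝ, 0 < α ∧ (mD - cS * r ^ 2) / r ≤ α ∧
      (∀ P₁ ∈ Riccati.posUpTo 𝕜 E r, ∀ P₂ ∈ Riccati.posUpTo 𝕜 E r, ∀ t : ℝ, 0 ≤ t →
        Riccati.thompsonDist (Riccati.flow (Riccati.riccatiField A D S) t P₁)
            (Riccati.flow (Riccati.riccatiField A D S) t P₂)
          ≤ Real.exp (-α * t) * Riccati.thompsonDist P₁ P₂) ∧
      ∃ Pbar ∈ Riccati.posUpTo 𝕜 E r,
        Riccati.SolvesARE A D S Pbar ∧
        (∀ Q ∈ Riccati.posUpTo 𝕜 E r, Riccati.SolvesARE A D S Q → Q = Pbar) ∧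
        ∀ P ∈ Riccati.posUpTo 𝕜 E r, ∀ t : ℝ, 0 ≤ t →
          Riccati.thompsonDist (Riccati.flow (Riccati.riccatiField A D S) t P) Pbar
            ≤ Real.exp (-α * t) * Riccati.thompsonDist P Pbar := by
  obtain ⟨hr₁, hr₂⟩ := hr
  set w := Real.sqrt (cA ^ 2 - cD * cS) with hw
  have hw0 : 0 ≤ w := Real.sqrt_nonneg _
  have hw2 : w ^ 2 = cA ^ 2 - cD * cS := Real.sq_sqrt (by linarith)
  have hwA : w < cA := by
    refine lt_of_pow_lt_pow_left₀ 2 hcA.le ?_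
    rw [hw2]
    linarith [mul_pos hcD hcS]
  have hr0 : 0 < r := (div_pos (by linarith) hcS).trans_le hr₁
  have hr₃ : cS * r ^ 2 < mD := by
    have h := (Real.lt_sqrt hr0.le).mp hr₂
    rw [lt_div_iff₀ hcS] at h
    linarith
  have hA' : Riccati.lyap A (1 : Riccati.SymOp 𝕜 E) ≤
      (-(2 * cA)) • (1 : Riccati.SymOp 𝕜 E) := by
    have h : (Riccati.lyap A (1 : Riccati.SymOp 𝕜 E) : E →L[𝕜] E) = A + star A := by
      rw [Riccati.coe_lyap, Riccati.SymOp.coe_one, mul_one, one_mul, add_comm]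
    rw [Riccati.SymOp.le_iff, h]
    exact hA
  have hsup : Riccati.riccatiField A D S (r • (1 : Riccati.SymOp 𝕜 E)) ≤ 0 := by
    refine Riccati.riccatiField_smul_one_nonpos hr0.le hA' hD_lower hD_upper hS fun hmc => ?_
    have h3 : cA - w ≤ cS * r := by
      rw [div_le_iff₀ hcS] at hr₁
      linarith
    have h4 : cS * r ≤ cA := by
      refine le_of_sq_le_sq ?_ hcA.le
      -- The upper end of the range for r gives cS r² < mD ≤ cD. This puts r left of the vertex
      -- cA/cS, hence between the two roots.
      calc (cS * r) ^ 2 = cS * (cS * r ^ 2) := by ring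
        _ ≤ cS * cD := by gcongr; linarith
        _ ≤ cA ^ 2 := by linarith
    have h5 : (cA - cS * r) ^ 2 ≤ w ^ 2 := by
      have : 0 ≤ cA - cS * r := by linarith
      gcongr
      linarith
    rw [hw2] at h5
    refine nonpos_of_mul_nonpos_right (a := cS) ?_ hcS
    linarith
  have hα : 0 < (mD - cS * r ^ 2) / r := div_pos (by linarith) hr0
  have hαr : (mD - cS * r ^ 2) / r * r = mD - cS * r ^ 2 := div_mul_cancel₀ _ hr0.ne'
  refine ⟨fun P hP => ?_, _, hα, le_rfl, fun P₁ hP₁ P₂ hP₂ t ht =>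
    Riccati.thompsonDist_flow_le hmD hcS.le hD_lower hS hr0.le hsup hα.le hαr hP₁ hP₂ ht, ?_⟩
  · obtain ⟨hsol, ε, hε, -, hb⟩ := Riccati.exists_flow_bounds hmD hD_lower hr0.le hsup hP
    exact ⟨hsol, fun a x hx t ht =>
      hx.eq_flow (Riccati.exists_lipschitzOnWith_riccatiField A D S) ht,
      fun t ht => Riccati.mem_posUpTo_iff.mpr ⟨⟨ε, hε, (hb t ht).1⟩, (hb t ht).2⟩⟩
  · obtain ⟨Pbar, hPbar, h0⟩ :=
      Riccati.exists_equilibrium hmD hcS.le hD_lower hS hr0 hsup hα hαr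
    refine ⟨Pbar, hPbar, (Riccati.riccatiField_eq_zero_iff A D S Pbar).mp h0, fun Q hQ hQ0 => ?_,
      fun P hP t ht => ?_⟩
    · exact Riccati.equilibrium_unique hmD hcS.le hD_lower hS hr0.le hsup hα hαr hQ hPbar
        ((Riccati.riccatiField_eq_zero_iff A D S Q).mpr hQ0) h0
    · have h := Riccati.thompsonDist_flow_le hmD hcS.le hD_lower hS hr0.le hsup hα.le hαr hP
        hPbar ht
      rwa [Riccati.flow_eq_self h0 ht] at h
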